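/- **Conventions.** In a braided strict monoidal category write $\diamond$ for the product, $\mathbb 1$ for the unit object, $\gamma$ for the braiding and $\bar\gamma=\gamma^{-1}$; $\mathrm{id}=\mathrm{id}_H$. A *Hopf algebra* is an object $H$ with morphisms $\Delta:H\to H\diamond H$, $\epsilon:H\to\mathbb 1$, $m:H\diamond H\to H$, $\eta:\mathbb 1\to H$, $S,\bar S:H\to H$ such that $(H,m,\eta)$ is an associative unital algebra, $(H,\Delta,\epsilon)$ is a coassociative counital coalgebra, $(m\diamond m)\circ(\mathrm{id}\diamond\gamma\diamond\mathrm{id})\circ(\Delta\diamond\Delta)=\Delta\circ m$, $\epsilon\circ m=\epsilon\diamond\epsilon$, $\Delta\circ\eta=\eta\diamond\eta$, $\epsilon\circ\eta=\mathrm{id}_{\mathbb 1}$, $m\circ(S\diamond\mathrm{id})\circ\Delta=\eta\circ\epsilon=m\circ(\mathrm{id}\diamond S)\circ\Delta$ and $S\circ\bar S=\bar S\circ S=\mathrm{id}$. Put $\alpha_1=m\circ(m\diamond S)\circ(\mathrm{id}\diamond\gamma)\circ(\Delta\diamond\mathrm{id}):H\diamond H\to H$. **The category $\bar{\bar{\mathcal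 H}}{}^r$** (the universal selfdual ribbon Hopf algebra) is the braided strict monoidal category freely generated by a Hopf algebra $H$ with an integral $L:\mathbb 1\to H$, a cointegral $l:H\to\mathbb 1$, an invertible ribbon morphism $v:H\to H$ and a copairing $\sigma:\mathbb 1\to H\diamond H$, subject to - $(\mathrm{id}\diamond l)\circ\Delta=\eta\circ l$, $\ m\circ(L\diamond\mathrm{id})=L\circ\epsilon$, $\ l\circ L=\mathrm{id}_{\mathbb 1}$, $\ l\circ S=l$, $\ S\circ L=L$; - $S\circ v=v\circ S$, $\ \epsilon\circ v=\epsilon$, $\ m\circ(v\diamond\mathrm{id})=v\circ m$, $\ \sigma=(v^{-1}\diamond(v^{-1}\circ S))\circ\Delta\circ v\circ\eta$; - $(\Delta\diamond\mathrm{id})\circ\sigma=(\mathrm{id}\diamond\mathrm{id}\diamond m)\circ(\mathrm{id}\diamond\sigma\diamond\mathrm{id})\circ\sigma$; - $\Delta\circ v^{-1}=(v^{-1}\diamond v^{-1})\circ\mu\circ\bar\gamma\circ\Delta$; - $(m\diamond m)\circ(S\diamond(\mu\circ\bar\gamma\circ\mu)\diamond S)\circ(\rho_l\diamond\rho_r)=\gamma$;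 - $(l\diamond\mathrm{id})\circ\sigma=L$, $\ l\circ v\circ\eta=\mathrm{id}_{\mathbb 1}$, where $\mu=(m\diamond m)\circ(\mathrm{id}\diamond\sigma\diamond\mathrm{id})$, $\rho_l=(\mathrm{id}\diamond m)\circ(\sigma\diamond\mathrm{id})$, $\rho_r=(m\diamond\mathrm{id})\circ(\mathrm{id}\diamond\sigma)$. Its pairing is $\bar\sigma=((l\circ m)\diamond(l\circ m))\circ(\mathrm{id}\diamond\sigma\diamond S):H\diamond H\to\mathbb 1$. **The category $\overline{\mathcal{A}lg}$** is the braided strict monoidal category freely generated by a Hopf algebra $H$ with ribbon elements $w_+,w_-:\mathbb 1\to H$, a copairing $\sigma:\mathbb 1\to H\diamond H$ and a pairing $\bar\sigma:H\diamond H\to\mathbb 1$, subject to - (h1) $m\circ(w_+\diamond\mathrm{id})=m\circ(\mathrm{id}\diamond w_+)$; (h2) $m\circ(w_+\diamond w_-)=\eta$; (h3) $\epsilon\circ w_+=\mathrm{id}_{\mathbb 1}$; (h4) $S\circ w_+=w_+$; - (h5) $\Delta\circ w_+=\big((m\circ(w_+\diamond\mathrm{id}))\diamond(m\circ(w_+\diamond\mathrm{id}))\big)\circ\sigma$;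 - (h6) $(\epsilon\diamond\mathrm{id})\circ\sigma=\eta=(\mathrm{id}\diamond\epsilon)\circ\sigma$; - (h7) $(\mathrm{id}\diamond\Delta)\circ\sigma=(m\diamond\mathrm{id}\diamond\mathrm{id})\circ(\mathrm{id}\diamond\sigma\diamond\mathrm{id})\circ\sigma$ and $(\Delta\diamond\mathrm{id})\circ\sigma=(\mathrm{id}\diamond\mathrm{id}\diamond m)\circ(\mathrm{id}\diamond\sigma\diamond\mathrm{id})\circ\sigma$; - (h8) $(\mathrm{id}\diamond\bar\sigma)\circ(\sigma\diamond\mathrm{id})=\mathrm{id}=(\bar\sigma\diamond\mathrm{id})\circ(\mathrm{id}\diamond\sigma)$; (h9) $m\circ(w_+\diamond w_+)=m\circ\sigma$; - (h10) $(\alpha_1\diamond\mathrm{id})\circ(\mathrm{id}\diamond\gamma)\circ(\Delta\diamond\mathrm{id})=\bar\gamma\circ(\mathrm{id}\diamond\alpha_1)\circ(\Delta\diamond\mathrm{id})$; - (h11) $\bar\sigma\circ(m\diamond\mathrm{id})\circ(w_+\diamond w_+\diamond w_+)=\mathrm{id}_{\mathbb 1}$; (h12) $S\circ S=(\mathrm{id}\diamond\bar\sigma)\circ(\gamma\diamond\mathrm{id})\circ(\mathrm{id}\diamond\sigma)$.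 **Theorem.** There is a (strict) braided monoidal functor $\Gamma:\overline{\mathcal{A}lg}\to\bar{\bar{\mathcal H}}{}^r$ with $\Gamma(H)=H$ which sends $\Delta,\epsilon,m,\eta,S,\bar S$, the copairing $\sigma$ and the pairing $\bar\sigma$ of $\overline{\mathcal{A}lg}$ to the corresponding morphisms of $\bar{\bar{\mathcal H}}{}^r$, and $$\Gamma(w_+)=v^{-1}\circ\eta,\qquad \Gamma(w_-)=v\circ\eta.$$ -/

import Mathlib

open CategoryTheory MonoidalCategory

/-! ## Braided strict monoidal categories presented by generators and relations -/

/-- Formal plane diagrams with `a` lower and `b` upper end points, built from elementary diagrams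
`g : G a b`.  An object `n` stands for the `n`-fold product `H ⋄ ⋯ ⋄ H`; in particular `0` is the
unit object and `1` is `H`. -/
inductive Diagram (G : ℕ → ℕ → Type) : ℕ → ℕ → Type
  /-- an elementary diagram -/
  | gen {a b : ℕ} (g : G a b) : Diagram G a b
  /-- the identity of `a` -/
  | ident (a : ℕ) : Diagram G a a
  /-- `comp f g` is `f ∘ g`: the diagram `f` stacked on top of `g` -/
  | comp {a b c : ℕ} (f : Diagram G b c) (g : Diagram G a b) : Diagram G a c
  /-- `tensor f g` is `f ⋄ g`: the diagram `g` placed on the right of `f` -/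
  | tensor {a b c d : ℕ} (f : Diagram G a b) (g : Diagram G c d) : Diagram G (a + c) (b + d)
  /-- the braiding morphism -/
  | braid (a b : ℕ) : Diagram G (a + b) (b + a)
  /-- the inverse of the braiding morphism `braid a b` -/
  | braidInv (a b : ℕ) : Diagram G (b + a) (a + b)

notation:80 f:81 " ⊚ " g:80 => Diagram.comp (f :) (g :)
notation:90 f:91 " ⋄ " g:90 => Diagram.tensor (f :) (g :)

/-- The identity of `a`, regarded as a diagram from `a` to `b` when `a = b`. -/
def Diagram.eqId {G : ℕ → ℕ → Type} {a b : ℕ} (h : a = b) : Diagram G a b :=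
  h ▸ Diagram.ident a

/-- The equivalence of diagrams generated by the relations `R`, the axioms of a strict monoidal
category and the axioms of a braiding. -/
inductive DiagramEq {G : ℕ → ℕ → Type}
    (R : ∀ {a b : ℕ}, Diagram G a b → Diagram G a b → Prop) :
    ∀ {a b : ℕ}, Diagram G a b → Diagram G a b → Prop
  | of_rel {a b : ℕ} {f g : Diagram G a b} : R f g → DiagramEq R f g
  -- congruence
  | refl {a b : ℕ} (f : Diagram G a b) : DiagramEq R f f
  | symm {a b : ℕ} {f g : Diagram G a b} : DiagramEq R f g → DiagramEq R g f
  | trans {a b : ℕ} {f g h : Diagram G a b} : DiagramEq R f g → DiagramEq R g h → DiagramEq R f h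
  | comp_congr {a b c : ℕ} {f f' : Diagram G b c} {g g' : Diagram G a b} :
      DiagramEq R f f' → DiagramEq R g g' → DiagramEq R (f ⊚ g) (f' ⊚ g')
  | tensor_congr {a b c d : ℕ} {f f' : Diagram G a b} {g g' : Diagram G c d} :
      DiagramEq R f f' → DiagramEq R g g' → DiagramEq R (f ⋄ g) (f' ⋄ g')
  -- category
  | id_comp {a b : ℕ} (f : Diagram G a b) : DiagramEq R (Diagram.ident b ⊚ f) f
  | comp_id {a b : ℕ} (f : Diagram G a b) : DiagramEq R (f ⊚ Diagram.ident a) f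
  | assoc {a b c d : ℕ} (f : Diagram G c d) (g : Diagram G b c) (h : Diagram G a b) :
      DiagramEq R ((f ⊚ g) ⊚ h) (f ⊚ (g ⊚ h))
  -- strict monoidal structure
  | id_tensor_id (a b : ℕ) :
      DiagramEq R (Diagram.ident a ⋄ Diagram.ident b) (Diagram.ident (a + b))
  | interchange {a b c a' b' c' : ℕ} (f : Diagram G b c) (g : Diagram G a b)
      (f' : Diagram G b' c') (g' : Diagram G a' b') :
      DiagramEq R ((f ⋄ f') ⊚ (g ⋄ g')) ((f ⊚ g) ⋄ (f' ⊚ g'))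
  | tensor_assoc {a b c d e k : ℕ} (f : Diagram G a b) (g : Diagram G c d) (h : Diagram G e k) :
      DiagramEq R (Diagram.eqId (Nat.add_assoc b d k) ⊚ ((f ⋄ g) ⋄ h))
        ((f ⋄ (g ⋄ h)) ⊚ Diagram.eqId (Nat.add_assoc a c e))
  | unit_tensor {a b : ℕ} (f : Diagram G a b) :
      DiagramEq R (Diagram.eqId (Nat.zero_add b) ⊚ (Diagram.ident 0 ⋄ f))
        (f ⊚ Diagram.eqId (Nat.zero_add a))
  | tensor_unit {a b : ℕ} (f : Diagram G a b) : DiagramEq R (f ⋄ Diagram.ident 0) f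
  -- braiding
  | braid_braidInv (a b : ℕ) :
      DiagramEq R (Diagram.braid a b ⊚ Diagram.braidInv a b) (Diagram.ident (b + a))
  | braidInv_braid (a b : ℕ) :
      DiagramEq R (Diagram.braidInv a b ⊚ Diagram.braid a b) (Diagram.ident (a + b))
  | braid_naturality {a b c d : ℕ} (f : Diagram G a b) (g : Diagram G c d) :
      DiagramEq R (Diagram.braid b d ⊚ (f ⋄ g)) ((g ⋄ f) ⊚ Diagram.braid a c)
  | braid_tensor_right (a b c : ℕ) :
      DiagramEq R
        (Diagram.eqId (Nat.add_assoc b c a) ⊚ Diagram.braid a (b + c) ⊚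
          Diagram.eqId (Nat.add_assoc a b c))
        ((Diagram.ident b ⋄ Diagram.braid a c) ⊚ Diagram.eqId (Nat.add_assoc b a c) ⊚
          (Diagram.braid a b ⋄ Diagram.ident c))
  | braid_tensor_left (a b c : ℕ) :
      DiagramEq R
        (Diagram.eqId (Nat.add_assoc c a b).symm ⊚ Diagram.braid (a + b) c ⊚
          Diagram.eqId (Nat.add_assoc a b c).symm)
        ((Diagram.braid a c ⋄ Diagram.ident b) ⊚ Diagram.eqId (Nat.add_assoc a c b).symm ⊚
          (Diagram.ident a ⋄ Diagram.braid b c))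

/-- Generators and relations for a braided strict monoidal category with object monoid `ℕ`. -/
structure BraidedPresentation where
  /-- the elementary diagrams -/
  Gen : ℕ → ℕ → Type
  /-- the defining relations -/
  Rel : ∀ {a b : ℕ}, Diagram Gen a b → Diagram Gen a b → Prop

namespace BraidedPresentation

variable (P : BraidedPresentation)

/-- The objects of the braided strict monoidal category presented by `P`. -/
def Cat (_P : BraidedPresentation) : Type := ℕ

/-- The product of objects. -/
protected def tensorObj (a b : P.Cat) : P.Cat := Nat.add a b

/-- The morphisms: diagrams modulo equivalence. -/
def Hom (a b : ℕ) : Type := Quot (DiagramEq (fun {_ _} => P.Rel) (a := a) (b := b))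

variable {P}

/-- The morphism represented by a diagram. -/
def homMk {a b : ℕ} (f : Diagram P.Gen a b) : P.Hom a b := Quot.mk _ f

theorem homMk_eq {a b : ℕ} {f g : Diagram P.Gen a b}
    (h : DiagramEq (fun {_ _} => P.Rel) f g) : (homMk f : P.Hom a b) = homMk g := Quot.sound h

/-- Composition, in diagrammatic order: `compHom f g` is `g ∘ f`. -/
def compHom {a b c : ℕ} (f : P.Hom a b) (g : P.Hom b c) : P.Hom a c :=
  Quot.map₂ (fun (f : Diagram P.Gen a b) (g : Diagram P.Gen b c) => g ⊚ f)
    (fun f _ _ h => .comp_congr h (.refl f)) (fun _ _ g h => .comp_congr (.refl g) h) f g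

/-- The product of morphisms. -/
def tensorHom {a b c d : ℕ} (f : P.Hom a b) (g : P.Hom c d) : P.Hom (a + c) (b + d) :=
  Quot.map₂ (fun (f : Diagram P.Gen a b) (g : Diagram P.Gen c d) => f ⋄ g)
    (fun f _ _ h => .tensor_congr (.refl f) h) (fun _ _ g h => .tensor_congr h (.refl g)) f g

instance : Category P.Cat where
  Hom a b := P.Hom a b
  id a := homMk (Diagram.ident (a : ℕ))
  comp f g := compHom f g
  id_comp := by rintro a b ⟨f⟩; exact homMk_eq (.comp_id f)
  comp_id := by rintro a b ⟨f⟩; exact homMk_eq (.id_comp f)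
  assoc := by rintro a b c d ⟨f⟩ ⟨g⟩ ⟨h⟩; exact homMk_eq (.symm (.assoc h g f))

theorem homMk_eqId {a b : P.Cat} (h : a = b) :
    (homMk (Diagram.eqId h) : P.Hom a b) = (eqToHom h : a ⟶ b) := by
  subst h; rfl

instance : MonoidalCategoryStruct P.Cat where
  tensorObj a b := BraidedPresentation.tensorObj P a b
  whiskerLeft a _ _ f := tensorHom (homMk (Diagram.ident (a : ℕ))) f
  whiskerRight f b := tensorHom f (homMk (Diagram.ident (b : ℕ)))
  tensorHom f g := tensorHom f g
  tensorUnit := (0 : ℕ)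
  associator a b c := eqToIso (Nat.add_assoc a b c)
  leftUnitor a := eqToIso (Nat.zero_add a)
  rightUnitor a := eqToIso (Nat.add_zero a)

theorem id_tensor_eqToHom (a : P.Cat) {b c : P.Cat} (h : b = c) :
    (𝟙 a ⊗ₘ eqToHom h) = eqToHom (congrArg (fun x => a ⊗ x) h) := by
  subst h; exact homMk_eq (.id_tensor_id _ _)

theorem eqToHom_tensor_id {a b : P.Cat} (h : a = b) (c : P.Cat) :
    (eqToHom h ⊗ₘ 𝟙 c) = eqToHom (congrArg (fun x => x ⊗ c) h) := by
  subst h; exact homMk_eq (.id_tensor_id _ _)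

theorem eqToHom_pentagon {a d x y z u w : P.Cat} (h₁ : x = y) (h₂ : y ⊗ d = a ⊗ z) (h₃ : z = u)
    (h₄ : x ⊗ d = w) (h₅ : w = a ⊗ u) :
    (eqToHom h₁ ⊗ₘ 𝟙 d) ≫ eqToHom h₂ ≫ (𝟙 a ⊗ₘ eqToHom h₃) = eqToHom h₄ ≫ eqToHom h₅ := by
  rw [eqToHom_tensor_id, id_tensor_eqToHom]
  simp only [eqToHom_trans]

theorem eqToHom_triangle {a b x y : P.Cat} (h₁ : y ⊗ b = a ⊗ x) (h₂ : x = b) (h₃ : y = a) :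
    eqToHom h₁ ≫ (𝟙 a ⊗ₘ eqToHom h₂) = (eqToHom h₃ ⊗ₘ 𝟙 b) := by
  rw [eqToHom_tensor_id, id_tensor_eqToHom]
  simp only [eqToHom_trans]

instance : MonoidalCategory P.Cat :=
  MonoidalCategory.ofTensorHom
    (id_tensorHom_id := fun _ _ => homMk_eq (.id_tensor_id _ _))
    (id_tensorHom := fun _ _ _ _ => rfl)
    (tensorHom_id := fun _ _ => rfl)
    (tensorHom_comp_tensorHom := by
      rintro _ _ _ _ _ _ ⟨f⟩ ⟨f'⟩ ⟨g⟩ ⟨g'⟩; exact homMk_eq (.interchange g f g' f'))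
    (associator_naturality := by
      rintro a c e b d k ⟨f⟩ ⟨g⟩ ⟨h⟩
      exact (congrArg (compHom (homMk ((f ⋄ g) ⋄ h))) (homMk_eqId _)).symm.trans
        ((homMk_eq (P := P) (.tensor_assoc f g h)).trans
          (congrArg (fun x => compHom x (homMk (f ⋄ (g ⋄ h)))) (homMk_eqId _))))
    (leftUnitor_naturality := by
      rintro a b ⟨f⟩
      exact (congrArg (compHom (homMk (Diagram.ident 0 ⋄ f))) (homMk_eqId _)).symm.trans
        ((homMk_eq (P := P) (.unit_tensor f)).trans
          (congrArg (fun x => compHom x (homMk f)) (homMk_eqId _))))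
    (rightUnitor_naturality := by
      rintro a b ⟨f⟩
      change (homMk (f ⋄ Diagram.ident 0) : P.Hom a b) ≫ 𝟙 (b : P.Cat) = 𝟙 (a : P.Cat) ≫ homMk f
      rw [Category.comp_id, Category.id_comp]
      exact homMk_eq (.tensor_unit f))
    (pentagon := fun _ _ _ _ => eqToHom_pentagon (Nat.add_assoc _ _ _) (Nat.add_assoc _ _ _)
      (Nat.add_assoc _ _ _) (Nat.add_assoc _ _ _) (Nat.add_assoc _ _ _))
    (triangle := fun _ _ => eqToHom_triangle (Nat.add_assoc _ _ _) (Nat.zero_add _)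
      (Nat.add_zero _))

/-- The braiding. -/
def braiding (a b : P.Cat) : a ⊗ b ≅ b ⊗ a where
  hom := homMk (Diagram.braid (a : ℕ) b)
  inv := homMk (Diagram.braidInv (a : ℕ) b)
  hom_inv_id := homMk_eq (.braidInv_braid _ _)
  inv_hom_id := homMk_eq (.braid_braidInv _ _)

instance : BraidedCategory P.Cat where
  braiding := braiding
  braiding_naturality_right := by
    rintro a b c ⟨f⟩; exact homMk_eq (.braid_naturality (Diagram.ident _) f)
  braiding_naturality_left := by
    rintro a b ⟨f⟩ c; exact homMk_eq (.braid_naturality f (Diagram.ident _))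
  hexagon_forward a b c := by
    have h₁ := homMk_eqId (P := P) (Nat.add_assoc a b c)
    have h₂ := homMk_eqId (P := P) (Nat.add_assoc b c a)
    have h₃ := homMk_eqId (P := P) (Nat.add_assoc b a c)
    have h := homMk_eq (P := P) (.braid_tensor_right a b c)
    change compHom (compHom (homMk _) (homMk _)) (homMk _) =
      compHom (compHom (homMk _) (homMk _)) (homMk _) at h
    erw [h₁, h₂, h₃] at h
    exact ((Category.assoc (obj := P.Cat) _ _ _).symm.trans h).trans
      (Category.assoc (obj := P.Cat) _ _ _)
  hexagon_reverse a b c := by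
    have h₁ := homMk_eqId (P := P) (Nat.add_assoc a b c).symm
    have h₂ := homMk_eqId (P := P) (Nat.add_assoc c a b).symm
    have h₃ := homMk_eqId (P := P) (Nat.add_assoc a c b).symm
    have h := homMk_eq (P := P) (.braid_tensor_left a b c)
    change compHom (compHom (homMk _) (homMk _)) (homMk _) =
      compHom (compHom (homMk _) (homMk _)) (homMk _) at h
    erw [h₁, h₂, h₃] at h
    exact ((Category.assoc (obj := P.Cat) _ _ _).symm.trans h).trans
      (Category.assoc (obj := P.Cat) _ _ _)

/-- The generating object `H`. -/
def H : P.Cat := (1 : ℕ)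

end BraidedPresentation

/-! ## Hopf algebras -/

/-- Diagrams for the structure morphisms of a Hopf algebra on the generating object. -/
structure HopfDiagrams (G : ℕ → ℕ → Type) where
  /-- the comultiplication -/
  Δ : Diagram G 1 2
  /-- the counit -/
  ε : Diagram G 1 0
  /-- the multiplication -/
  m : Diagram G 2 1
  /-- the unit -/
  η : Diagram G 0 1
  /-- the antipode -/
  S : Diagram G 1 1
  /-- the inverse of the antipode -/
  Sinv : Diagram G 1 1

namespace HopfDiagrams

open Diagram

variable {G : ℕ → ℕ → Type}

/-- The relations of a Hopf algebra in a braided monoidal category. -/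
inductive Rel (A : HopfDiagrams G) : ∀ {a b : ℕ}, Diagram G a b → Diagram G a b → Prop
  | coassoc : Rel A (a := 1) (b := 3) ((A.Δ ⋄ ident 1) ⊚ A.Δ) ((ident 1 ⋄ A.Δ) ⊚ A.Δ)
  | counit_left : Rel A (a := 1) (b := 1) ((A.ε ⋄ ident 1) ⊚ A.Δ) (ident 1)
  | counit_right : Rel A (a := 1) (b := 1) ((ident 1 ⋄ A.ε) ⊚ A.Δ) (ident 1)
  | assoc : Rel A (a := 3) (b := 1) (A.m ⊚ (A.m ⋄ ident 1)) (A.m ⊚ (ident 1 ⋄ A.m))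
  | mul_comul : Rel A (a := 2) (b := 2)
      ((A.m ⋄ A.m) ⊚ (ident 1 ⋄ braid 1 1 ⋄ ident 1) ⊚ (A.Δ ⋄ A.Δ)) (A.Δ ⊚ A.m)
  | mul_counit : Rel A (a := 2) (b := 0) (A.ε ⊚ A.m) (A.ε ⋄ A.ε)
  | mul_unit : Rel A (a := 1) (b := 1) (A.m ⊚ (ident 1 ⋄ A.η)) (ident 1)
  | unit_mul : Rel A (a := 1) (b := 1) (A.m ⊚ (A.η ⋄ ident 1)) (ident 1)
  | unit_comul : Rel A (a := 0) (b := 2) (A.Δ ⊚ A.η) (A.η ⋄ A.η)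
  | unit_counit : Rel A (a := 0) (b := 0) (A.ε ⊚ A.η) (ident 0)
  | antipode_left : Rel A (a := 1) (b := 1) (A.m ⊚ (A.S ⋄ ident 1) ⊚ A.Δ) (A.η ⊚ A.ε)
  | antipode_right : Rel A (a := 1) (b := 1) (A.m ⊚ (ident 1 ⋄ A.S) ⊚ A.Δ) (A.η ⊚ A.ε)
  | S_Sinv : Rel A (a := 1) (b := 1) (A.S ⊚ A.Sinv) (ident 1)
  | Sinv_S : Rel A (a := 1) (b := 1) (A.Sinv ⊚ A.S) (ident 1)

/-- The left adjoint morphism `α₁ : H ⋄ H → H`. -/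
def ad (A : HopfDiagrams G) : Diagram G 2 1 :=
  A.m ⊚ (A.m ⋄ A.S) ⊚ (ident 1 ⋄ braid 1 1) ⊚ (A.Δ ⋄ ident 1)

end HopfDiagrams

/-! ## The universal ribbon and the universal selfdual ribbon Hopf algebra -/

namespace RibbonHopf

open Diagram

/-- The elementary diagrams of the universal ribbon Hopf algebra. -/
inductive Gen : ℕ → ℕ → Type
  | comul : Gen 1 2
  | counit : Gen 1 0
  | mul : Gen 2 1
  | unit : Gen 0 1
  | antipode : Gen 1 1
  | antipodeInv : Gen 1 1
  /-- the integral `L` -/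
  | integral : Gen 0 1
  /-- the cointegral `l` -/
  | cointegral : Gen 1 0
  /-- the ribbon morphism `v` -/
  | ribbon : Gen 1 1
  /-- the inverse of the ribbon morphism -/
  | ribbonInv : Gen 1 1
  /-- the copairing `σ` -/
  | copairing : Gen 0 2

/-- The underlying Hopf algebra. -/
def hopf : HopfDiagrams Gen where
  Δ := gen .comul
  ε := gen .counit
  m := gen .mul
  η := gen .unit
  S := gen .antipode
  Sinv := gen .antipodeInv

/-- the comultiplication -/
abbrev Δ : Diagram Gen 1 2 := hopf.Δ
/-- the counit -/
abbrev ε : Diagram Gen 1 0 := hopf.ε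
/-- the multiplication -/
abbrev m : Diagram Gen 2 1 := hopf.m
/-- the unit -/
abbrev η : Diagram Gen 0 1 := hopf.η
/-- the antipode -/
abbrev S : Diagram Gen 1 1 := hopf.S
/-- the inverse of the antipode -/
abbrev Sinv : Diagram Gen 1 1 := hopf.Sinv
/-- the integral -/
abbrev L : Diagram Gen 0 1 := gen .integral
/-- the cointegral -/
abbrev l : Diagram Gen 1 0 := gen .cointegral
/-- the ribbon morphism -/
abbrev v : Diagram Gen 1 1 := gen .ribbon
/-- the inverse of the ribbon morphism -/
abbrev vinv : Diagram Gen 1 1 := gen .ribbonInv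
/-- the copairing -/
abbrev σ : Diagram Gen 0 2 := gen .copairing

/-- `μ = (m ⋄ m) ∘ (id ⋄ σ ⋄ id)` -/
def μ : Diagram Gen 2 2 := (m ⋄ m) ⊚ (ident 1 ⋄ σ ⋄ ident 1)

/-- `ρ_l = (id ⋄ m) ∘ (σ ⋄ id)` -/
def ρl : Diagram Gen 1 2 := (ident 1 ⋄ m) ⊚ (σ ⋄ ident 1)

/-- `ρ_r = (m ⋄ id) ∘ (id ⋄ σ)` -/
def ρr : Diagram Gen 1 2 := (m ⋄ ident 1) ⊚ (ident 1 ⋄ σ)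

/-- The relations of a ribbon Hopf algebra. -/
inductive Rel : ∀ {a b : ℕ}, Diagram Gen a b → Diagram Gen a b → Prop
  | hopf {a b : ℕ} {f g : Diagram Gen a b} : hopf.Rel f g → Rel f g
  -- the integral axioms
  | cointegral_comul : Rel (a := 1) (b := 1) ((ident 1 ⋄ l) ⊚ Δ) (η ⊚ l)
  | integral_mul : Rel (a := 1) (b := 1) (m ⊚ (L ⋄ ident 1)) (L ⊚ ε)
  | cointegral_integral : Rel (a := 0) (b := 0) (l ⊚ L) (ident 0)
  | cointegral_antipode : Rel (a := 1) (b := 0) (l ⊚ S) l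
  | antipode_integral : Rel (a := 0) (b := 1) (S ⊚ L) L
  -- the ribbon axioms
  | v_vinv : Rel (a := 1) (b := 1) (v ⊚ vinv) (ident 1)
  | vinv_v : Rel (a := 1) (b := 1) (vinv ⊚ v) (ident 1)
  | antipode_v : Rel (a := 1) (b := 1) (S ⊚ v) (v ⊚ S)
  | counit_v : Rel (a := 1) (b := 0) (ε ⊚ v) ε
  | mul_v : Rel (a := 2) (b := 1) (m ⊚ (v ⋄ ident 1)) (v ⊚ m)
  | copairing_eq : Rel (a := 0) (b := 2) σ ((vinv ⋄ (vinv ⊚ S)) ⊚ Δ ⊚ v ⊚ η)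
  | comul_copairing : Rel (a := 0) (b := 3)
      ((Δ ⋄ ident 1) ⊚ σ) ((ident 1 ⋄ ident 1 ⋄ m) ⊚ (ident 1 ⋄ σ ⋄ ident 1) ⊚ σ)
  | comul_vinv : Rel (a := 1) (b := 2)
      (Δ ⊚ vinv) ((vinv ⋄ vinv) ⊚ μ ⊚ braidInv 1 1 ⊚ Δ)
  | braid_eq : Rel (a := 2) (b := 2)
      ((m ⋄ m) ⊚ (S ⋄ (μ ⊚ braidInv 1 1 ⊚ μ) ⋄ S) ⊚ (ρl ⋄ ρr)) (braid 1 1)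

/-- The relations of a selfdual ribbon Hopf algebra. -/
inductive SelfdualRel : ∀ {a b : ℕ}, Diagram Gen a b → Diagram Gen a b → Prop
  | ribbon {a b : ℕ} {f g : Diagram Gen a b} : Rel f g → SelfdualRel f g
  | duality : SelfdualRel (a := 0) (b := 1) ((l ⋄ ident 1) ⊚ σ) L
  | normalization : SelfdualRel (a := 0) (b := 0) (l ⊚ v ⊚ η) (ident 0)

/-- The form `l ∘ m : H ⋄ H → 𝟙`. -/
def form : Diagram Gen 2 0 := l ⊚ m

/-- The pairing `σ̄ = (form ⋄ form) ∘ (id ⋄ σ ⋄ S) : H ⋄ H → 𝟙`. -/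
def pairing : Diagram Gen 2 0 := (form ⋄ form) ⊚ (ident 1 ⋄ σ ⋄ S)

end RibbonHopf

/-- The universal ribbon Hopf algebra `H^r`: the braided strict monoidal category freely generated
by a ribbon Hopf algebra. -/
abbrev Hr : Type := (BraidedPresentation.mk RibbonHopf.Gen RibbonHopf.Rel).Cat

/-- Generators and relations of the universal selfdual ribbon Hopf algebra. -/
abbrev selfdualPresentation : BraidedPresentation where
  Gen := RibbonHopf.Gen
  Rel := RibbonHopf.SelfdualRel

/-- The universal selfdual ribbon Hopf algebra: the quotient of `Hr` by duality and
normalization. -/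
abbrev Hbb : Type := selfdualPresentation.Cat

namespace Hbb

open RibbonHopf

/-- The generating object. -/
abbrev H : Hbb := BraidedPresentation.H

/-- the morphism of `Hbb` represented by a diagram -/
abbrev mk {a b : ℕ} (f : Diagram Gen a b) : selfdualPresentation.Hom a b := BraidedPresentation.homMk f

/-- the comultiplication -/
def comul : H ⟶ H ⊗ H := mk RibbonHopf.Δ
/-- the counit -/
def counit : H ⟶ 𝟙_ Hbb := mk RibbonHopf.ε
/-- the multiplication -/
def mul : H ⊗ H ⟶ H := mk RibbonHopf.m
/-- the unit -/
def unit : 𝟙_ Hbb ⟶ H := mk RibbonHopf.η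
/-- the antipode -/
def antipode : H ⟶ H := mk RibbonHopf.S
/-- the inverse of the antipode -/
def antipodeInv : H ⟶ H := mk RibbonHopf.Sinv
/-- the ribbon morphism `v` -/
def ribbon : H ⟶ H := mk RibbonHopf.v
/-- the inverse of the ribbon morphism -/
def ribbonInv : H ⟶ H := mk RibbonHopf.vinv
/-- the copairing `σ` -/
def copairing : 𝟙_ Hbb ⟶ H ⊗ H := mk RibbonHopf.σ
/-- the pairing `σ̄` -/
def pairing : H ⊗ H ⟶ 𝟙_ Hbb := mk RibbonHopf.pairing

end Hbb

/-! ## The category `Alg-bar` -/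

namespace AlgBarDiagram

open Diagram

/-- The elementary diagrams of `Alg-bar`. -/
inductive Gen : ℕ → ℕ → Type
  | comul : Gen 1 2
  | counit : Gen 1 0
  | mul : Gen 2 1
  | unit : Gen 0 1
  | antipode : Gen 1 1
  | antipodeInv : Gen 1 1
  /-- the ribbon element `w₊` -/
  | wPlus : Gen 0 1
  /-- the ribbon element `w₋` -/
  | wMinus : Gen 0 1
  /-- the copairing `σ` -/
  | copairing : Gen 0 2
  /-- the pairing `σ̄` -/
  | pairing : Gen 2 0

/-- The underlying Hopf algebra. -/
def hopf : HopfDiagrams Gen where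
  Δ := gen .comul
  ε := gen .counit
  m := gen .mul
  η := gen .unit
  S := gen .antipode
  Sinv := gen .antipodeInv

/-- the comultiplication -/
abbrev Δ : Diagram Gen 1 2 := hopf.Δ
/-- the counit -/
abbrev ε : Diagram Gen 1 0 := hopf.ε
/-- the multiplication -/
abbrev m : Diagram Gen 2 1 := hopf.m
/-- the unit -/
abbrev η : Diagram Gen 0 1 := hopf.η
/-- the antipode -/
abbrev S : Diagram Gen 1 1 := hopf.S
/-- the inverse of the antipode -/
abbrev Sinv : Diagram Gen 1 1 := hopf.Sinv
/-- the ribbon element `w₊` -/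
abbrev wp : Diagram Gen 0 1 := gen .wPlus
/-- the ribbon element `w₋` -/
abbrev wm : Diagram Gen 0 1 := gen .wMinus
/-- the copairing -/
abbrev σ : Diagram Gen 0 2 := gen .copairing
/-- the pairing -/
abbrev σbar : Diagram Gen 2 0 := gen .pairing

/-- The relations of `Alg-bar`: those of a Hopf algebra, and the relations `h1` to `h12`. -/
inductive Rel : ∀ {a b : ℕ}, Diagram Gen a b → Diagram Gen a b → Prop
  | hopf {a b : ℕ} {f g : Diagram Gen a b} : hopf.Rel f g → Rel f g
  | h1 : Rel (a := 1) (b := 1) (m ⊚ (wp ⋄ ident 1)) (m ⊚ (ident 1 ⋄ wp))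
  | h2 : Rel (a := 0) (b := 1) (m ⊚ (wp ⋄ wm)) η
  | h3 : Rel (a := 0) (b := 0) (ε ⊚ wp) (ident 0)
  | h4 : Rel (a := 0) (b := 1) (S ⊚ wp) wp
  /-- the comultiplication of `w₊` is `σ` with both legs multiplied by `w₊` -/
  | h5 : Rel (a := 0) (b := 2)
      (Δ ⊚ wp) (((m ⊚ (wp ⋄ ident 1)) ⋄ (m ⊚ (wp ⋄ ident 1))) ⊚ σ)
  | h6 : Rel (a := 0) (b := 1) ((ε ⋄ ident 1) ⊚ σ) η
  | h6' : Rel (a := 0) (b := 1) ((ident 1 ⋄ ε) ⊚ σ) η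
  | h7 : Rel (a := 0) (b := 3)
      ((ident 1 ⋄ Δ) ⊚ σ) ((m ⋄ ident 1 ⋄ ident 1) ⊚ (ident 1 ⋄ σ ⋄ ident 1) ⊚ σ)
  | h7' : Rel (a := 0) (b := 3)
      ((Δ ⋄ ident 1) ⊚ σ) ((ident 1 ⋄ ident 1 ⋄ m) ⊚ (ident 1 ⋄ σ ⋄ ident 1) ⊚ σ)
  | h8 : Rel (a := 1) (b := 1) ((ident 1 ⋄ σbar) ⊚ (σ ⋄ ident 1)) (ident 1)
  | h8' : Rel (a := 1) (b := 1) ((σbar ⋄ ident 1) ⊚ (ident 1 ⋄ σ)) (ident 1)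
  | h9 : Rel (a := 0) (b := 1) (m ⊚ (wp ⋄ wp)) (m ⊚ σ)
  | h10 : Rel (a := 2) (b := 2)
      ((hopf.ad ⋄ ident 1) ⊚ (ident 1 ⋄ braid 1 1) ⊚ (Δ ⋄ ident 1))
      (braidInv 1 1 ⊚ (ident 1 ⋄ hopf.ad) ⊚ (Δ ⋄ ident 1))
  | h11 : Rel (a := 0) (b := 0) (σbar ⊚ (m ⋄ ident 1) ⊚ (wp ⋄ wp ⋄ wp)) (ident 0)
  | h12 : Rel (a := 1) (b := 1)
      (S ⊚ S) ((ident 1 ⋄ σbar) ⊚ (braid 1 1 ⋄ ident 1) ⊚ (ident 1 ⋄ σ))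

end AlgBarDiagram

/-- Generators and relations of `Alg-bar`. -/
abbrev algBarPresentation : BraidedPresentation where
  Gen := AlgBarDiagram.Gen
  Rel := AlgBarDiagram.Rel

/-- The universal braided strict monoidal category `Alg-bar`. -/
abbrev AlgBar : Type := algBarPresentation.Cat

namespace AlgBar

open AlgBarDiagram

/-- The generating object. -/
abbrev H : AlgBar := BraidedPresentation.H

/-- the morphism of `AlgBar` represented by a diagram -/
abbrev mk {a b : ℕ} (f : Diagram Gen a b) : algBarPresentation.Hom a b := BraidedPresentation.homMk f

/-- the comultiplication -/
def comul : H ⟶ H ⊗ H := mk AlgBarDiagram.Δ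
/-- the counit -/
def counit : H ⟶ 𝟙_ AlgBar := mk AlgBarDiagram.ε
/-- the multiplication -/
def mul : H ⊗ H ⟶ H := mk AlgBarDiagram.m
/-- the unit -/
def unit : 𝟙_ AlgBar ⟶ H := mk AlgBarDiagram.η
/-- the antipode -/
def antipode : H ⟶ H := mk AlgBarDiagram.S
/-- the inverse of the antipode -/
def antipodeInv : H ⟶ H := mk AlgBarDiagram.Sinv
/-- the ribbon element `w₊` -/
def wPlus : 𝟙_ AlgBar ⟶ H := mk AlgBarDiagram.wp
/-- the ribbon element `w₋` -/
def wMinus : 𝟙_ AlgBar ⟶ H := mk AlgBarDiagram.wm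
/-- the copairing `σ` -/
def copairing : 𝟙_ AlgBar ⟶ H ⊗ H := mk AlgBarDiagram.σ
/-- the pairing `σ̄` -/
def pairing : H ⊗ H ⟶ 𝟙_ AlgBar := mk AlgBarDiagram.σbar

end AlgBar

/-! ## Strict monoidal functors -/

/-- A monoidal functor is strict if it preserves the unit object and products of objects on the
nose and its structure morphisms are identities. -/
structure IsStrictMonoidal {C D : Type*} [Category* C] [Category* D] [MonoidalCategory C]
    [MonoidalCategory D] (F : C ⥤ D) [F.Monoidal] : Prop where
  obj_unit : F.obj (𝟙_ C) = 𝟙_ D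
  obj_tensor : ∀ X Y : C, F.obj (X ⊗ Y) = F.obj X ⊗ F.obj Y
  ε_eq : Functor.LaxMonoidal.ε F = eqToHom obj_unit.symm
  μ_eq : ∀ X Y : C, Functor.LaxMonoidal.μ F X Y = eqToHom (obj_tensor X Y).symm

/-! A functor out of a category given by generators and relations exists once the images of the
generators satisfy the relations. So everything reduces to proving the Hopf relations and (h1)-(h12)
in the selfdual ribbon category, with `w₊ = v⁻¹ ∘ η` and `w₋ = v ∘ η`.

Since `v` commutes with multiplication on both sides (`mul_v`, `mul_v_right`), it acts as a central
element, and the relations on `w₊` and `w₋` alone follow from the ribbon axioms. The formula for `σ`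
in terms of `v` shows that reversing `σ` by a crossing costs the square of `S` or of its inverse
(`X_copairing`, `Y_copairing`). This turns the axiom for `(Δ ⋄ id) ∘ σ` into the one for `(id ⋄ Δ) ∘
σ` (`copairing_comul`).

Nondegeneracy (h8) rests on the integral: `l ∘ m` and `Δ ∘ L` are dual up to the inverse antipode
(`form_comul_integral`), and two copies of `σ` joined by `l ∘ m` give `Δ ∘ L`
(`form_copairing_copairing`). Duality of `σ` and `σ̄` then transfers `Y_copairing` to the pairing
and yields (h12). Relation (h11) comes from `l ∘ v⁻¹ ∘ η = id`.

The hardest relation is (h10). The axiom expressing the braiding through `μ` gives, after cancelling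
a copy of `σ` against its inverse, an identity for the adjoint action precomposed with `μ`
(`mul_X_ρl`, `antipode_ρr_μ_Y_μ`). The effect of `μ` is undone by `ad_twist` and `ad_untwist`, and
nondegeneracy of `σ` removes the remaining copairing.

The diagram calculus is made computable: a diagram is flattened to a list of layers, each
manipulation is a script of sound rewriting steps, and the kernel checks that the script ends at the
expected list. -/

/-! ## Arrows of a presented category, with their ends as data -/

namespace BraidedPresentation

/-- A morphism of the category presented by `P`, bundled with its source and its target. -/
structure Arrow (P : BraidedPresentation) where
  /-- the source -/
  {src : ℕ}
  /-- the target -/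
  {tgt : ℕ}
  /-- the morphism -/
  hom : P.Hom src tgt

namespace Arrow

variable {P : BraidedPresentation}

/-- The arrow represented by a diagram. -/
def mk' {a b : ℕ} (f : Diagram P.Gen a b) : Arrow P := ⟨(homMk f : P.Hom a b)⟩

theorem mk'_surjective (f : Arrow P) : ∃ (a b : ℕ) (d : Diagram P.Gen a b), f = mk' d := by
  obtain @⟨a, b, ⟨d⟩⟩ := f
  exact ⟨a, b, d, rfl⟩

theorem mk'_eq_iff {a b : ℕ} {f g : Diagram P.Gen a b} :
    (mk' f : Arrow P) = mk' g ↔ (homMk f : P.Hom a b) = homMk g :=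
  ⟨fun h => by simpa [mk'] using h, fun h => by simp [mk', h]⟩

theorem mk'_eq {a b : ℕ} {f g : Diagram P.Gen a b}
    (h : DiagramEq (fun {_ _} => P.Rel) f g) : (mk' f : Arrow P) = mk' g :=
  mk'_eq_iff.2 (homMk_eq h)

theorem mk'_eqId_comp {a b c : ℕ} (h : b = c) (f : Diagram P.Gen a b) :
    (mk' (Diagram.eqId h ⊚ f) : Arrow P) = mk' f := by
  subst h; exact mk'_eq (.id_comp f)

theorem mk'_comp_eqId {a b c : ℕ} (h : a = b) (f : Diagram P.Gen b c) :
    (mk' (f ⊚ Diagram.eqId h) : Arrow P) = mk' f := by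
  subst h; exact mk'_eq (.comp_id f)

/-- The identity of `n`. -/
def id (n : ℕ) : Arrow P := mk' (.ident n)

/-- With the ends bundled as data, strict associativity and unitality of the product become plain
equations, so no transport along equalities of objects is needed in the calculations. -/
instance : Monoid (Arrow P) where
  mul f g := ⟨tensorHom f.hom g.hom⟩
  one := id 0
  mul_assoc f g h := by
    obtain ⟨_, _, f, rfl⟩ := f.mk'_surjective
    obtain ⟨_, _, g, rfl⟩ := g.mk'_surjective
    obtain ⟨_, _, h, rfl⟩ := h.mk'_surjective
    exact (mk'_eqId_comp (Nat.add_assoc _ _ _) _).symm.trans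
      ((mk'_eq (.tensor_assoc f g h)).trans (mk'_comp_eqId _ _))
  one_mul f := by
    obtain ⟨_, _, f, rfl⟩ := f.mk'_surjective
    exact (mk'_eqId_comp (Nat.zero_add _) _).symm.trans
      ((mk'_eq (.unit_tensor f)).trans (mk'_comp_eqId _ _))
  mul_one f := by
    obtain ⟨_, _, f, rfl⟩ := f.mk'_surjective
    exact mk'_eq (.tensor_unit f)

theorem mk'_mul {a b c d : ℕ} (f : Diagram P.Gen a b) (g : Diagram P.Gen c d) :
    (mk' f * mk' g : Arrow P) = mk' (f ⋄ g) := rfl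

theorem id_mul_id (a b : ℕ) : (id a * id b : Arrow P) = id (a + b) := mk'_eq (.id_tensor_id a b)

theorem id_zero : (id 0 : Arrow P) = 1 := rfl

@[simp] theorem src_mul (f g : Arrow P) : (f * g).src = f.src + g.src := rfl
@[simp] theorem tgt_mul (f g : Arrow P) : (f * g).tgt = f.tgt + g.tgt := rfl
@[simp] theorem src_id (n : ℕ) : (id n : Arrow P).src = n := rfl
@[simp] theorem tgt_id (n : ℕ) : (id n : Arrow P).tgt = n := rfl
@[simp] theorem src_mk' {a b : ℕ} (f : Diagram P.Gen a b) : (mk' f : Arrow P).src = a := rfl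
@[simp] theorem tgt_mk' {a b : ℕ} (f : Diagram P.Gen a b) : (mk' f : Arrow P).tgt = b := rfl

/-- Composition in diagrammatic order; it is only meaningful when the ends match. -/
def comp (f g : Arrow P) : Arrow P :=
  if h : g.src = f.tgt then ⟨compHom f.hom (h ▸ g.hom)⟩ else f

theorem mk'_comp {a b c : ℕ} (f : Diagram P.Gen a b) (g : Diagram P.Gen b c) :
    (mk' f).comp (mk' g : Arrow P) = mk' (g ⊚ f) := by
  simp [comp, mk', compHom, homMk, Quot.map₂]

theorem src_comp {f g : Arrow P} : (f.comp g).src = f.src := by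
  unfold comp; split <;> rfl

theorem tgt_comp {f g : Arrow P} (h : g.src = f.tgt) : (f.comp g).tgt = g.tgt := by
  simp [comp, h]

theorem comp_assoc {f g h : Arrow P} (hfg : g.src = f.tgt) (hgh : h.src = g.tgt) :
    (f.comp g).comp h = f.comp (g.comp h) := by
  obtain ⟨a, b, f, rfl⟩ := f.mk'_surjective
  obtain ⟨b', c, g, rfl⟩ := g.mk'_surjective
  obtain ⟨c', d, h, rfl⟩ := h.mk'_surjective
  change b' = b at hfg
  change c' = c at hgh
  subst hfg hgh
  rw [mk'_comp, mk'_comp, mk'_comp, mk'_comp]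
  exact mk'_eq (.symm (.assoc _ _ _))

theorem id_comp {n : ℕ} {f : Arrow P} (h : f.src = n) : (id n).comp f = f := by
  obtain ⟨a, b, f, rfl⟩ := f.mk'_surjective
  change a = n at h
  subst h
  exact (mk'_comp _ _).trans (mk'_eq (.comp_id f))

theorem comp_id {n : ℕ} {f : Arrow P} (h : f.tgt = n) : f.comp (id n) = f := by
  obtain ⟨a, b, f, rfl⟩ := f.mk'_surjective
  change b = n at h
  subst h
  exact (mk'_comp _ _).trans (mk'_eq (.id_comp f))

theorem mul_comp_mul {f g f' g' : Arrow P} (h : g.src = f.tgt) (h' : g'.src = f'.tgt) :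
    (f * f').comp (g * g') = f.comp g * f'.comp g' := by
  obtain ⟨a, b, f, rfl⟩ := f.mk'_surjective
  obtain ⟨c, d, g, rfl⟩ := g.mk'_surjective
  obtain ⟨a', b', f', rfl⟩ := f'.mk'_surjective
  obtain ⟨c', d', g', rfl⟩ := g'.mk'_surjective
  change c = b at h
  change c' = b' at h'
  subst h h'
  rw [mk'_mul, mk'_mul, mk'_comp, mk'_comp, mk'_comp, mk'_mul]
  exact mk'_eq (.interchange _ _ _ _)

theorem whisker_exchange (f g : Arrow P) :
    (f * id g.src).comp (id f.tgt * g) = (id f.src * g).comp (f * id g.tgt) := by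
  rw [mul_comp_mul rfl rfl, mul_comp_mul rfl rfl, comp_id rfl, id_comp rfl, id_comp rfl,
    comp_id rfl]

/-- The braiding. -/
def braid (a b : ℕ) : Arrow P := mk' (.braid a b)

/-- The inverse of the braiding. -/
def braidInv (a b : ℕ) : Arrow P := mk' (.braidInv a b)

theorem braidInv_comp_braid (a b : ℕ) : (braidInv a b : Arrow P).comp (braid a b) = id (b + a) :=
  (mk'_comp _ _).trans (mk'_eq (.braid_braidInv a b))

theorem braid_naturality (f g : Arrow P) :
    (f * g).comp (braid f.tgt g.tgt) = (braid f.src g.src).comp (g * f) := by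
  obtain ⟨a, b, f, rfl⟩ := f.mk'_surjective
  obtain ⟨c, d, g, rfl⟩ := g.mk'_surjective
  exact (mk'_comp _ _).trans ((mk'_eq (.braid_naturality f g)).trans (mk'_comp _ _).symm)

theorem braid_add_left (a b c : ℕ) :
    (braid (a + b) c : Arrow P) = (id a * braid b c).comp (braid a c * id b) := by
  have h := mk'_eq (P := P) (.braid_tensor_left a b c)
  rw [mk'_eqId_comp, mk'_comp_eqId, ← mk'_comp, mk'_eqId_comp] at h
  exact h

theorem braid_add_right (a b c : ℕ) :
    (braid a (b + c) : Arrow P) = (braid a b * id c).comp (id b * braid a c) := by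
  have h := mk'_eq (P := P) (.braid_tensor_right a b c)
  rw [mk'_eqId_comp, mk'_comp_eqId, ← mk'_comp, mk'_eqId_comp] at h
  exact h

/-- The hexagon for `0 + 0` makes this braiding idempotent, and an invertible idempotent is an
identity. -/
theorem braid_zero_left (a : ℕ) : (braid 0 a : Arrow P) = id a := by
  have h : (braid 0 a : Arrow P) = (braid 0 a).comp (braid 0 a) := by
    simpa [id_zero] using braid_add_left (P := P) 0 0 a
  have h' := congrArg (braidInv 0 a).comp h
  rw [← comp_assoc (by rfl) (by simp [braid]), braidInv_comp_braid, id_comp (by simp [braid])] at h'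
  simpa using h'.symm

theorem braid_zero_right (a : ℕ) : (braid a 0 : Arrow P) = id a := by
  have h : (braid a 0 : Arrow P) = (braid a 0).comp (braid a 0) := by
    simpa [id_zero] using braid_add_right (P := P) a 0 0
  have h' := congrArg (braidInv a 0).comp h
  rw [← comp_assoc (by rfl) (by simp [braid]), braidInv_comp_braid, id_comp (by simp [braid])] at h'
  simpa using h'.symm

end Arrow
end BraidedPresentation

/-! ## Words of layers -/

namespace RibbonHopf

open BraidedPresentation

/-- The elementary diagrams and the braidings, without types. -/
inductive Op
  | comul | counit | mul | unit | antipode | antipodeInv | integral | cointegral | ribbon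
  | ribbonInv | copairing
  | braid (a b : ℕ)
  | braidInv (a b : ℕ)
  deriving DecidableEq

namespace Op

/-- The number of lower end points. -/
def src : Op → ℕ
  | comul => 1 | counit => 1 | mul => 2 | unit => 0 | antipode => 1 | antipodeInv => 1
  | integral => 0 | cointegral => 1 | ribbon => 1 | ribbonInv => 1 | copairing => 0
  | braid a b => a + b | braidInv a b => b + a

/-- The number of upper end points. -/
def tgt : Op → ℕ
  | comul => 2 | counit => 0 | mul => 1 | unit => 1 | antipode => 1 | antipodeInv => 1
  | integral => 1 | cointegral => 0 | ribbon => 1 | ribbonInv => 1 | copairing => 2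
  | braid a b => b + a | braidInv a b => a + b

/-- The underlying diagram. -/
def diagram : (o : Op) → Diagram Gen o.src o.tgt
  | comul => Δ | counit => ε | mul => m | unit => η | antipode => S | antipodeInv => Sinv
  | integral => L | cointegral => l | ribbon => v | ribbonInv => vinv | copairing => σ
  | braid a b => .braid a b | braidInv a b => .braidInv a b

/-- The elementary diagram `g`, without its type. -/
def ofGen {a b : ℕ} : Gen a b → Op
  | .comul => comul | .counit => counit | .mul => mul | .unit => unit | .antipode => antipode
  | .antipodeInv => antipodeInv | .integral => integral | .cointegral => cointegral
  | .ribbon => ribbon | .ribbonInv => ribbonInv | .copairing => copairing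

/-- The arrow of the universal selfdual ribbon Hopf algebra represented by `o`. -/
def arrow (o : Op) : Arrow selfdualPresentation := .mk' o.diagram

@[simp] theorem src_arrow (o : Op) : o.arrow.src = o.src := rfl
@[simp] theorem tgt_arrow (o : Op) : o.arrow.tgt = o.tgt := rfl

theorem arrow_ofGen {a b : ℕ} (g : Gen a b) : (ofGen g).arrow = .mk' (.gen g) := by
  cases g <;> rfl

end Op

/-- A word of layers: the layer `(k, o)` is `o` with `k` strands on its left, and the first layer
of the word is the lowest one. -/
abbrev Word : Type := List (ℕ × Op)

namespace Word

/-- The number of upper end points of `w` placed on `n` strands, if `w` fits there. -/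
def width : ℕ → Word → Option ℕ
  | n, [] => some n
  | n, x :: w => if x.1 + x.2.src ≤ n then width (n - x.2.src + x.2.tgt) w else none

/-- The arrow of one layer on `n` strands. -/
def layer (n : ℕ) (x : ℕ × Op) : Arrow selfdualPresentation :=
  -- The subtraction is truncated, so the value has the right ends only when the layer fits on `n`
  -- strands; `width` tests this.
  .id x.1 * x.2.arrow * .id (n - x.1 - x.2.src)

/-- The arrow represented by a word on `n` strands. -/
def eval : ℕ → Word → Arrow selfdualPresentation
  | n, [] => .id n
  | n, x :: w => (layer n x).comp (eval (n - x.2.src + x.2.tgt) w)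

/-- The word `w` with `k` more strands on its left. -/
def shift (k : ℕ) (w : Word) : Word := w.map fun x => (k + x.1, x.2)

theorem src_layer {n : ℕ} {x : ℕ × Op} (h : x.1 + x.2.src ≤ n) : (layer n x).src = n := by
  simp [layer]; omega

theorem tgt_layer {n : ℕ} {x : ℕ × Op} (h : x.1 + x.2.src ≤ n) :
    (layer n x).tgt = n - x.2.src + x.2.tgt := by
  simp [layer]; omega

theorem width_cons {n m : ℕ} {x : ℕ × Op} {w : Word} :
    width n (x :: w) = some m ↔ x.1 + x.2.src ≤ n ∧ width (n - x.2.src + x.2.tgt) w = some m := by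
  simp [width]

theorem src_eval {n m : ℕ} {w : Word} (h : width n w = some m) : (eval n w).src = n := by
  cases w with
  | nil => rfl
  | cons x w => rw [eval, Arrow.src_comp, src_layer (width_cons.1 h).1]

theorem tgt_eval {n m : ℕ} {w : Word} (h : width n w = some m) : (eval n w).tgt = m := by
  induction w generalizing n with
  | nil => exact Option.some.inj h
  | cons x w ih =>
    obtain ⟨hx, hw⟩ := width_cons.1 h
    rw [eval, Arrow.tgt_comp (by rw [src_eval hw, tgt_layer hx]), ih hw]

theorem width_append {n k m : ℕ} {u w : Word} (hu : width n u = some k) (hw : width k w = some m) :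
    width n (u ++ w) = some m := by
  induction u generalizing n with
  | nil => obtain rfl : n = k := by simpa [width] using hu
           exact hw
  | cons x u ih =>
    obtain ⟨hx, hu⟩ := width_cons.1 hu
    exact width_cons.2 ⟨hx, ih hu⟩

theorem width_append_iff {n m : ℕ} {u w : Word} :
    width n (u ++ w) = some m ↔ ∃ k, width n u = some k ∧ width k w = some m := by
  induction u generalizing n with
  | nil => simp [width]
  | cons x u ih => simp [width_cons, ih, and_assoc]

theorem eval_append {n k m : ℕ} {u w : Word} (hu : width n u = some k) (hw : width k w = some m) :
    eval n (u ++ w) = (eval n u).comp (eval k w) := by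
  induction u generalizing n with
  | nil =>
    obtain rfl : n = k := by simpa [width] using hu
    exact (Arrow.id_comp (src_eval hw)).symm
  | cons x u ih =>
    obtain ⟨hx, hu⟩ := width_cons.1 hu
    simp only [List.cons_append, eval]
    rw [ih hu, Arrow.comp_assoc (by rw [src_eval hu, tgt_layer hx])
      (by rw [src_eval hw, tgt_eval hu])]

theorem width_shift {n m : ℕ} {w : Word} (h : width n w = some m) (k r : ℕ) :
    width (k + n + r) (shift k w) = some (k + m + r) := by
  induction w generalizing n with
  | nil => obtain rfl := Option.some.inj h
           rfl
  | cons x w ih =>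
    obtain ⟨hx, hw⟩ := width_cons.1 h
    refine width_cons.2 ⟨by dsimp; omega, ?_⟩
    rw [← ih hw]
    congr 1
    dsimp
    omega

theorem layer_shift {n : ℕ} {x : ℕ × Op} (h : x.1 + x.2.src ≤ n) (k r : ℕ) :
    layer (k + n + r) (k + x.1, x.2) = .id k * layer n x * .id r := by
  have : k + n + r - (k + x.1) - x.2.src = n - x.1 - x.2.src + r := by omega
  simp only [layer, this, ← Arrow.id_mul_id, mul_assoc]

theorem eval_shift {n m : ℕ} {w : Word} (h : width n w = some m) (k r : ℕ) :
    eval (k + n + r) (shift k w) = .id k * eval n w * .id r := by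
  induction w generalizing n with
  | nil => simp only [shift, List.map_nil, eval, Arrow.id_mul_id]
  | cons x w ih =>
    obtain ⟨hx, hw⟩ := width_cons.1 h
    have e : k + n + r - x.2.src + x.2.tgt = k + (n - x.2.src + x.2.tgt) + r := by omega
    have hs : (eval (n - x.2.src + x.2.tgt) w).src = (layer n x).tgt := by
      rw [src_eval hw, tgt_layer hx]
    have := ih hw
    simp only [shift] at this
    simp only [shift, List.map_cons, eval, e, this]
    rw [layer_shift hx, Arrow.mul_comp_mul (by simp [hs]) rfl, Arrow.mul_comp_mul rfl hs,
      Arrow.id_comp (Arrow.src_id k), Arrow.id_comp (Arrow.src_id r)]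

/-! ### Flattening of diagrams -/

/-- The word of a diagram. -/
def ofDiagram {a b : ℕ} : Diagram Gen a b → Word
  | .gen g => [(0, .ofGen g)]
  | .ident _ => []
  | .comp f g => ofDiagram g ++ ofDiagram f
  | .tensor (b := b) f g => ofDiagram f ++ shift b (ofDiagram g)
  | .braid a b => [(0, .braid a b)]
  | .braidInv a b => [(0, .braidInv a b)]

theorem eval_singleton (o : Op) : eval o.src [(0, o)] = o.arrow := by
  simp only [eval, layer, Nat.sub_zero, Nat.sub_self, Nat.zero_add, Arrow.id_zero, one_mul,
    mul_one]
  exact Arrow.comp_id rfl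

theorem width_singleton (o : Op) : width o.src [(0, o)] = some o.tgt := by
  simp [width]

/-- Soundness of flattening. The product case rests on `f ⋄ g = (id ⋄ g) ∘ (f ⋄ id)`, where placing
strands beside a word is evaluated by `eval_shift`. -/
theorem width_eval_ofDiagram {a b : ℕ} (f : Diagram Gen a b) :
    width a (ofDiagram f) = some b ∧ eval a (ofDiagram f) = .mk' f := by
  induction f with
  | gen g =>
    -- The ends of `g` agree with those of `ofGen g` only after case analysis; the equation of
    -- arrows carries both equalities.
    have h := Op.arrow_ofGen g
    have hs : (Op.ofGen g).src = _ := congrArg Arrow.src h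
    have ht : (Op.ofGen g).tgt = _ := congrArg Arrow.tgt h
    have h₁ := width_singleton (Op.ofGen g)
    have h₂ := eval_singleton (Op.ofGen g)
    rw [hs, ht] at h₁
    rw [hs, h] at h₂
    exact ⟨h₁, h₂⟩
  | ident a => exact ⟨rfl, rfl⟩
  | comp f g ihf ihg =>
    refine ⟨width_append ihg.1 ihf.1, ?_⟩
    rw [ofDiagram, eval_append ihg.1 ihf.1, ihf.2, ihg.2, Arrow.mk'_comp]
  | @tensor a b c d f g ihf ihg =>
    have hf : width (a + c) (ofDiagram f) = some (b + c) := by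
      simpa [shift] using width_shift ihf.1 0 c
    have hg : width (b + c) (shift b (ofDiagram g)) = some (b + d) := width_shift ihg.1 b 0
    have ef : eval (a + c) (ofDiagram f) = .mk' f * .id c := by
      have := eval_shift ihf.1 0 c
      rw [ihf.2, Arrow.id_zero, one_mul] at this
      simpa [shift] using this
    have eg : eval (b + c) (shift b (ofDiagram g)) = .id b * .mk' g := by
      have := eval_shift ihg.1 b 0
      rw [ihg.2, Arrow.id_zero, mul_one] at this
      exact this
    refine ⟨width_append hf hg, ?_⟩
    rw [ofDiagram, eval_append hf hg, ef, eg, Arrow.mul_comp_mul rfl rfl]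
    exact congrArg₂ (· * ·) (Arrow.comp_id rfl) (Arrow.id_comp rfl)
  | braid a b => exact ⟨width_singleton (.braid a b), eval_singleton (.braid a b)⟩
  | braidInv a b => exact ⟨width_singleton (.braidInv a b), eval_singleton (.braidInv a b)⟩

end Word

end RibbonHopf

namespace RibbonHopf

open BraidedPresentation

/-! ### Equivalence of words -/

/-- `u` and `w`, placed on `n` strands, have `m` upper end points and represent the same
morphism. -/
structure Word.Equiv (n m : ℕ) (u w : Word) : Prop where
  width_left : u.width n = some m
  width_right : w.width n = some m
  eval_eq : u.eval n = w.eval n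

namespace Word.Equiv

variable {n k m : ℕ} {u u' w w' x : Word}

theorem refl (h : u.width n = some m) : Equiv n m u u := ⟨h, h, rfl⟩

theorem symm (h : Equiv n m u w) : Equiv n m w u := ⟨h.2, h.1, h.3.symm⟩

theorem trans (h : Equiv n m u w) (h' : Equiv n m w x) : Equiv n m u x :=
  ⟨h.1, h'.2, h.3.trans h'.3⟩

theorem append (h : Equiv n k u u') (h' : Equiv k m w w') : Equiv n m (u ++ w) (u' ++ w') :=
  ⟨width_append h.1 h'.1, width_append h.2 h'.2, by
    rw [eval_append h.1 h'.1, eval_append h.2 h'.2, h.3, h'.3]⟩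

theorem shift (h : Equiv n m u w) (k r : ℕ) :
    Equiv (k + n + r) (k + m + r) (shift k u) (shift k w) :=
  ⟨width_shift h.1 k r, width_shift h.2 k r, by rw [eval_shift h.1, eval_shift h.2, h.3]⟩

theorem cons {x : ℕ × Op} (hx : x.1 + x.2.src ≤ n) (h : Equiv (n - x.2.src + x.2.tgt) m u w) :
    Equiv n m (x :: u) (x :: w) :=
  ⟨width_cons.2 ⟨hx, h.1⟩, width_cons.2 ⟨hx, h.2⟩, by rw [eval, eval, h.3]⟩

/-- Interchange of layers. -/
theorem interchange {i s : ℕ} {f g : Op} (h : i + f.src + s + g.src ≤ n) :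
    Equiv n (n - f.src + f.tgt - g.src + g.tgt) [(i, f), (i + f.tgt + s, g)]
      [(i + f.src + s, g), (i, f)] := by
  obtain ⟨r, rfl⟩ := Nat.exists_eq_add_of_le h
  have h₁ : width (i + f.src + s + g.src + r) [(i, f), (i + f.tgt + s, g)] =
      some (i + f.src + s + g.src + r - f.src + f.tgt - g.src + g.tgt) := by
    simp only [width_cons]
    exact ⟨by omega, by omega, rfl⟩
  have h₂ : width (i + f.src + s + g.src + r) [(i + f.src + s, g), (i, f)] =
      some (i + f.src + s + g.src + r - f.src + f.tgt - g.src + g.tgt) := by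
    simp only [width_cons]
    exact ⟨by omega, by omega, congrArg some (by omega)⟩
  refine ⟨h₁, h₂, ?_⟩
  -- The `s` strands between the two layers are absorbed into the second one, so one exchange
  -- suffices.
  have key := Arrow.whisker_exchange f.arrow (.id s * g.arrow)
  simp only [Arrow.src_mul, Arrow.src_id, Op.src_arrow, Arrow.tgt_mul, Arrow.tgt_id,
    Op.tgt_arrow] at key
  have expand : ∀ x y : Arrow selfdualPresentation, y.src = x.tgt →
      (Arrow.id i * x * Arrow.id r).comp (Arrow.id i * y * Arrow.id r) =
        Arrow.id i * x.comp y * Arrow.id r := by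
    intro x y h
    rw [Arrow.mul_comp_mul (by simp [h]) rfl, Arrow.mul_comp_mul rfl h,
      Arrow.id_comp (Arrow.src_id i), Arrow.id_comp (Arrow.src_id r)]
  have last : ∀ a b : ℕ, ∀ x : ℕ × Op, x.1 + x.2.src ≤ a → b = a - x.2.src + x.2.tgt →
      (layer a x).comp (.id b) = layer a x := by
    rintro a b x hx rfl
    exact Arrow.comp_id (tgt_layer hx)
  simp only [eval]
  rw [last _ _ _ (by dsimp; omega) rfl, last _ _ _ (by dsimp; omega) rfl]
  simp only [layer]
  have e₁ : i + f.src + s + g.src + r - i - f.src = s + g.src + r := by omega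
  have e₂ : i + f.src + s + g.src + r - f.src + f.tgt - (i + f.tgt + s) - g.src = r := by omega
  have e₃ : i + f.src + s + g.src + r - (i + f.src + s) - g.src = r := by omega
  have e₄ : i + f.src + s + g.src + r - g.src + g.tgt - i - f.src = s + g.tgt + r := by omega
  rw [e₁, e₂, e₃, e₄]
  have := congrArg (fun x => Arrow.id i * x * Arrow.id r) key
  rw [← expand _ _ (by simp), ← expand _ _ (by simp)] at this
  simpa only [← Arrow.id_mul_id, mul_assoc] using this

end Word.Equiv

/-! ### Rewriting of words by interchange and replacement. -/

namespace Word

open Word.Equiv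

/-- Interchange of the first two layers of a word, if they are disjoint. -/
def swapHead : Word → Word
  | x :: y :: w =>
    if x.1 + x.2.tgt ≤ y.1 then (x.1 + x.2.src + (y.1 - (x.1 + x.2.tgt)), y.2) :: x :: w
    else if y.1 + y.2.src ≤ x.1 then y :: (y.1 + y.2.tgt + (x.1 - (y.1 + y.2.src)), x.2) :: w
    else x :: y :: w
  | w => w

/-- Interchange of the layers `i` and `i + 1` of a word, if they are disjoint. -/
def swap : ℕ → Word → Word
  | 0, w => swapHead w
  | i + 1, x :: w => x :: swap i w
  | _ + 1, [] => []

theorem equiv_swapHead {n m : ℕ} {w : Word} (h : w.width n = some m) :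
    Equiv n m w (swapHead w) := by
  match w with
  | [] => exact .refl h
  | [_] => exact .refl h
  | x :: y :: w =>
    obtain ⟨hx, hyw⟩ := width_cons.1 h
    obtain ⟨hy, hw⟩ := width_cons.1 hyw
    simp only [swapHead]
    split_ifs with h₁ h₂
    · obtain ⟨s, hs⟩ := Nat.exists_eq_add_of_le h₁
      have e : y.1 - (x.1 + x.2.tgt) = s := by omega
      rw [e]
      have := (interchange (n := n) (i := x.1) (s := s) (f := x.2) (g := y.2)
        (by omega)).append (.refl hw)
      rw [← hs] at this
      exact this
    · obtain ⟨s, hs⟩ := Nat.exists_eq_add_of_le h₂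
      have e : x.1 - (y.1 + y.2.src) = s := by omega
      rw [e]
      have e' : n - x.2.src + x.2.tgt - y.2.src + y.2.tgt =
          n - y.2.src + y.2.tgt - x.2.src + x.2.tgt := by omega
      rw [e'] at hw
      have := (interchange (n := n) (i := y.1) (s := s) (f := y.2) (g := x.2)
        (by omega)).symm.append (.refl hw)
      rw [← hs] at this
      exact this
    · exact .refl h

theorem equiv_swap {n m : ℕ} (i : ℕ) {w : Word} (h : w.width n = some m) :
    Equiv n m w (swap i w) := by
  induction i generalizing n w with
  | zero => exact equiv_swapHead h
  | succ i ih =>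
    cases w with
    | nil => exact .refl h
    | cons x w => exact .cons (width_cons.1 h).1 (ih (width_cons.1 h).2)

/-- Move the layer `i` of a word over the next `d` layers. -/
def moveUp (i : ℕ) : ℕ → Word → Word
  | 0, w => w
  | d + 1, w => moveUp (i + 1) d (swap i w)

/-- Move the layer `i + d` of a word down to the place `i`. -/
def moveDown (i : ℕ) : ℕ → Word → Word
  | 0, w => w
  | d + 1, w => moveDown i d (swap (i + d) w)

theorem equiv_moveUp {n m : ℕ} (i d : ℕ) {w : Word} (h : w.width n = some m) :
    Equiv n m w (moveUp i d w) := by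
  induction d generalizing i w with
  | zero => exact .refl h
  | succ d ih => exact (equiv_swap i h).trans (ih (i + 1) (equiv_swap i h).2)

theorem equiv_moveDown {n m : ℕ} (i d : ℕ) {w : Word} (h : w.width n = some m) :
    Equiv n m w (moveDown i d w) := by
  induction d generalizing w with
  | zero => exact .refl h
  | succ d ih => exact (equiv_swap (i + d) h).trans (ih (equiv_swap (i + d) h).2)

/-- Replace the subword `u` with `k` strands on its left, which begins at the layer `i` of `w`
and is placed on at least `n` further strands, by `u'`. -/
def replace (N n : ℕ) (u u' : Word) (i k : ℕ) (w : Word) : Word :=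
  if shift k u = (w.drop i).take u.length then
    match width N (w.take i) with
    | some M => if k + n ≤ M then w.take i ++ (shift k u' ++ (w.drop i).drop u.length) else w
    | none => w
  else w

/-- No matching hypothesis is needed, because `replace` returns `w` unchanged when the subword does
not occur at the given place or there are too few strands. -/
theorem equiv_replace {N M n m : ℕ} {u u' w : Word} (h : Equiv n m u u') (i k : ℕ)
    (hw : w.width N = some M) : Equiv N M w (replace N n u u' i k w) := by
  unfold replace
  split_ifs with h₁
  · split
    · rename_i K hK
      split_ifs with h₂
      · have e : w = w.take i ++ (shift k u ++ (w.drop i).drop u.length) := by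
          rw [h₁]; simp
        obtain ⟨r, rfl⟩ := Nat.exists_eq_add_of_le h₂
        have hw' := hw
        rw [e] at hw'
        obtain ⟨K', hK', hr⟩ := width_append_iff.1 hw'
        obtain rfl : k + n + r = K' := by simpa [hK] using hK'
        obtain ⟨K'', hK'', hr⟩ := width_append_iff.1 hr
        have hs := h.shift k r
        obtain rfl : k + m + r = K'' := by simpa [hs.1] using hK''
        have := (Equiv.refl hK).append (hs.append (.refl hr))
        rwa [← e] at this
      · exact .refl hw
    · exact .refl hw
  · exact .refl hw

/-- A step of a computation with words. -/
inductive Step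
  /-- move the layer `i` to the place `j` -/
  | mv (i j : ℕ)
  /-- apply an equivalence at the layer `i`, with `k` strands on the left -/
  | rw {n m : ℕ} {u w : Word} (h : Equiv n m u w) (i k : ℕ)

/-- Perform one step, starting from a word on `N` strands. -/
def Step.run (N : ℕ) (w : Word) : Step → Word
  | .mv i j => if i ≤ j then moveUp i (j - i) w else moveDown j (i - j) w
  | @Step.rw n _ u u' _ i k => replace N n u u' i k w

/-- Perform a list of steps, starting from a word on `N` strands. -/
def run (N : ℕ) (w : Word) (s : List Step) : Word := s.foldl (Step.run N) w

/-- Every script is sound, whatever its indices. A wrong script can therefore only fail to reach the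
intended word, which makes the final comparison of lists the sole condition to check. -/
theorem equiv_run {N M : ℕ} {w : Word} (h : w.width N = some M) (s : List Step) :
    Equiv N M w (run N w s) := by
  induction s generalizing w with
  | nil => exact .refl h
  | cons x s ih =>
    have hx : Equiv N M w (x.run N w) := by
      cases x with
      | mv i j =>
        simp only [Step.run]
        split_ifs
        exacts [equiv_moveUp _ _ h, equiv_moveDown _ _ h]
      | rw h' i k => exact equiv_replace h' i k h
    exact hx.trans (ih hx.2)

end Word

/-! ### Equality of diagrams -/

/-- The diagrams `f` and `g` represent the same morphism of the universal selfdual ribbon Hopf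
algebra. -/
abbrev Eqv {a b : ℕ} (f g : Diagram Gen a b) : Prop :=
  Word.Equiv a b (.ofDiagram f) (.ofDiagram g)

notation:50 f:51 " ≋ " g:51 => Eqv f g

theorem eqv_iff {a b : ℕ} {f g : Diagram Gen a b} :
    f ≋ g ↔ (homMk f : selfdualPresentation.Hom a b) = homMk g := by
  have hf := Word.width_eval_ofDiagram f
  have hg := Word.width_eval_ofDiagram g
  constructor
  · intro h
    exact Arrow.mk'_eq_iff.1 (hf.2.symm.trans (h.3.trans hg.2))
  · intro h
    exact ⟨hf.1, hg.1, by rw [hf.2, hg.2, Arrow.mk'_eq_iff.2 h]⟩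

theorem Eqv.of_rel {a b : ℕ} {f g : Diagram Gen a b} (h : SelfdualRel f g) : f ≋ g :=
  eqv_iff.2 (homMk_eq (.of_rel h))

instance {a b : ℕ} : Trans (Eqv (a := a) (b := b)) Eqv Eqv := ⟨Word.Equiv.trans⟩

/-- Prove an equality of diagrams by a list of steps. -/
theorem Eqv.of_steps {a b : ℕ} {f g : Diagram Gen a b} (s : List Word.Step)
    (h : Word.run a (.ofDiagram f) s = .ofDiagram g) : f ≋ g := by
  have := Word.equiv_run (Word.width_eval_ofDiagram f).1 s
  rwa [h] at this

end RibbonHopf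

namespace RibbonHopf

open BraidedPresentation

/-! ### Crossings -/

/-- The identity of `H`. -/
abbrev I : Diagram Gen 1 1 := .ident 1
/-- The crossing. -/
abbrev X : Diagram Gen 2 2 := .braid 1 1
/-- The inverse crossing. -/
abbrev Y : Diagram Gen 2 2 := .braidInv 1 1

theorem X_Y : X ⊚ Y ≋ Diagram.ident 2 := eqv_iff.2 (homMk_eq (.braid_braidInv 1 1))

theorem Y_X : Y ⊚ X ≋ Diagram.ident 2 := eqv_iff.2 (homMk_eq (.braidInv_braid 1 1))

namespace Word

/-- The strand on the right of `a` strands moves to the left by crossings `c`. -/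
def crossLeft (c : Op) : ℕ → Word
  | 0 => []
  | a + 1 => (a, c) :: crossLeft c a

/-- The strand on the left of `a` strands moves to the right by crossings `c`. -/
def crossRight (c : Op) : ℕ → Word
  | 0 => []
  | a + 1 => crossRight c a ++ [(a, c)]

theorem width_crossLeft {c : Op} (hs : c.src = 2) (ht : c.tgt = 2) (a r : ℕ) :
    width (a + 1 + r) (crossLeft c a) = some (a + 1 + r) := by
  induction a generalizing r with
  | zero => rfl
  | succ a ih =>
    refine width_cons.2 ⟨by dsimp; omega, ?_⟩
    have e : a + 1 + 1 + r - c.src + c.tgt = a + 1 + (r + 1) := by omega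
    dsimp only
    rw [e, ih (r + 1)]
    congr 1
    omega

theorem width_crossRight {c : Op} (hs : c.src = 2) (ht : c.tgt = 2) (a r : ℕ) :
    width (a + 1 + r) (crossRight c a) = some (a + 1 + r) := by
  induction a generalizing r with
  | zero => rfl
  | succ a ih =>
    have e : a + 1 + 1 + r = a + 1 + (r + 1) := by omega
    rw [e]
    refine width_append (ih (r + 1)) (width_cons.2 ⟨by dsimp; omega, ?_⟩)
    simp only [width]
    congr 1
    omega

/-- The hexagon splits off one strand at a time. This lets naturality of the general braiding be
used on words containing only elementary crossings. -/
theorem eval_crossLeft (a : ℕ) : eval (a + 1) (crossLeft (.braid 1 1) a) = .braid a 1 := by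
  induction a with
  | zero => exact (Arrow.braid_zero_left 1).symm
  | succ a ih =>
    have hw := width_crossLeft (c := .braid 1 1) rfl rfl a 0
    have h := eval_shift hw 0 1
    simp only [shift, Nat.zero_add, Prod.mk.eta, List.map_id', Nat.add_zero, ih, Arrow.id_zero,
      one_mul] at h
    have e : a + 1 + 1 - (Op.braid 1 1).src + (Op.braid 1 1).tgt = a + 1 + 1 := by
      simp [Op.src, Op.tgt]
    have e' : a + 1 + 1 - a - (Op.braid 1 1).src = 0 := by simp [Op.src]; omega
    simp only [crossLeft, eval, layer, e, e', h, Arrow.id_zero, mul_one]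
    exact (Arrow.braid_add_left a 1 1).symm

theorem eval_crossRight (a : ℕ) : eval (a + 1) (crossRight (.braid 1 1) a) = .braid 1 a := by
  induction a with
  | zero => exact (Arrow.braid_zero_right 1).symm
  | succ a ih =>
    have hw := width_crossRight (c := .braid 1 1) rfl rfl a 0
    have h := eval_shift hw 0 1
    simp only [shift, Nat.zero_add, Prod.mk.eta, List.map_id', Nat.add_zero, ih, Arrow.id_zero,
      one_mul] at h
    have hl : width (a + 1 + 1) [(a, .braid 1 1)] = some (a + 1 + 1) :=
      width_cons.2 ⟨by simp [Op.src], by simp [Op.src, Op.tgt, width]⟩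
    have e' : a + 1 + 1 - a - (Op.braid 1 1).src = 0 := by simp [Op.src]; omega
    have he : eval (a + 1 + 1) [(a, .braid 1 1)] = .id a * (Op.braid 1 1).arrow := by
      simp only [eval, layer, e', Arrow.id_zero, mul_one]
      refine Arrow.comp_id ?_
      simp [Op.src, Op.tgt]
    rw [crossRight, eval_append (width_crossRight rfl rfl a 1) hl, h, he]
    exact (Arrow.braid_add_right 1 a 1).symm

theorem crossRight_crossLeft {c c' : Op} (hs : c.src = 2) (ht : c.tgt = 2) (hs' : c'.src = 2)
    (ht' : c'.tgt = 2) (h : Equiv 2 2 [(0, c), (0, c')] []) (a r : ℕ) :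
    Equiv (a + 1 + r) (a + 1 + r) (crossRight c a ++ crossLeft c' a) [] := by
  induction a generalizing r with
  | zero => exact .refl rfl
  | succ a ih =>
    have h := h.shift a r
    rw [show a + 2 + r = a + 1 + (r + 1) by omega] at h
    have := ((Equiv.refl (width_crossRight hs ht a (r + 1))).append h).append
      (.refl (width_crossLeft hs' ht' a (r + 1)))
    rw [show a + 1 + 1 + r = a + 1 + (r + 1) by omega]
    refine .trans ?_ (ih (r + 1))
    simpa [crossRight, crossLeft, shift] using this

theorem crossLeft_crossRight {c c' : Op} (hs : c.src = 2) (ht : c.tgt = 2) (hs' : c'.src = 2)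
    (ht' : c'.tgt = 2) (h : Equiv 2 2 [(0, c), (0, c')] []) (a r : ℕ) :
    Equiv (a + 1 + r) (a + 1 + r) (crossLeft c a ++ crossRight c' a) [] := by
  induction a generalizing r with
  | zero => exact .refl rfl
  | succ a ih =>
    have h := h.shift a r
    rw [show a + 2 + r = a + 1 + (r + 1) by omega] at h
    have hc : width (a + 1 + (r + 1)) [(a, c)] = some (a + 1 + (r + 1)) :=
      width_cons.2 ⟨by dsimp; omega, congrArg some (by dsimp; omega)⟩
    have hc' : width (a + 1 + (r + 1)) [(a, c')] = some (a + 1 + (r + 1)) :=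
      width_cons.2 ⟨by dsimp; omega, congrArg some (by dsimp; omega)⟩
    have := ((Equiv.refl hc).append (ih (r + 1))).append (.refl hc')
    rw [show a + 1 + 1 + r = a + 1 + (r + 1) by omega]
    refine .trans ?_ h
    simpa [crossRight, crossLeft, shift] using this

theorem width_left (o : Op) : width (o.src + 1) [(0, o)] = some (o.tgt + 1) := by
  simp [width]; omega

theorem width_right (o : Op) : width (o.src + 1) [(1, o)] = some (o.tgt + 1) := by
  simp [width]; omega

theorem eval_left (o : Op) : eval (o.src + 1) [(0, o)] = o.arrow * .id 1 := by
  have := eval_shift (width_singleton o) 0 1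
  simpa [shift, eval_singleton, Arrow.id_zero] using this

theorem eval_right (o : Op) : eval (o.src + 1) [(1, o)] = .id 1 * o.arrow := by
  have := eval_shift (width_singleton o) 1 0
  simpa [shift, eval_singleton, Arrow.id_zero, Nat.add_comm 1] using this

end Word

open Word

/-- A strand moves from the right of a layer to the left. -/
theorem X_right (o : Op) : Word.Equiv (o.src + 1) (o.tgt + 1)
    ((0, o) :: crossLeft (.braid 1 1) o.tgt) (crossLeft (.braid 1 1) o.src ++ [(1, o)]) := by
  have h (a : ℕ) := width_crossLeft (c := .braid 1 1) rfl rfl a 0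
  have hl := width_append (width_left o) (h o.tgt)
  have hr := width_append (h o.src) (width_right o)
  refine ⟨hl, hr, ?_⟩
  rw [← List.singleton_append, eval_append (width_left o) (h o.tgt),
    eval_append (h o.src) (width_right o), Nat.add_zero, Nat.add_zero, eval_left, eval_right,
    eval_crossLeft, eval_crossLeft]
  exact Arrow.braid_naturality o.arrow (.id 1)

/-- A strand moves from the left of a layer to the right. -/
theorem X_left (o : Op) : Word.Equiv (o.src + 1) (o.tgt + 1)
    ((1, o) :: crossRight (.braid 1 1) o.tgt) (crossRight (.braid 1 1) o.src ++ [(0, o)]) := by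
  have h (a : ℕ) := width_crossRight (c := .braid 1 1) rfl rfl a 0
  have hl := width_append (width_right o) (h o.tgt)
  have hr := width_append (h o.src) (width_left o)
  refine ⟨hl, hr, ?_⟩
  rw [← List.singleton_append, eval_append (width_right o) (h o.tgt),
    eval_append (h o.src) (width_left o), Nat.add_zero, Nat.add_zero, eval_left, eval_right,
    eval_crossRight, eval_crossRight]
  exact Arrow.braid_naturality (.id 1) o.arrow

/-- A strand moves from the right of a layer to the left, by inverse crossings. -/
theorem Y_right (o : Op) : Word.Equiv (o.src + 1) (o.tgt + 1)
    ((0, o) :: crossLeft (.braidInv 1 1) o.tgt) (crossLeft (.braidInv 1 1) o.src ++ [(1, o)]) := by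
  have h (a : ℕ) := Word.Equiv.refl (width_crossLeft (c := .braidInv 1 1) rfl rfl a 0)
  -- Conjugation by crossings: a cancelling pair is inserted below the layer, `X_left` slides its
  -- second half above, and that half cancels with the inverse crossings there.
  have h₁ := ((crossLeft_crossRight rfl rfl rfl rfl X_Y o.src 0).symm.append
    (.refl (width_left o))).append (h o.tgt)
  have h₂ := (h o.src).append ((X_left o).symm.append (h o.tgt))
  have h₃ := (h o.src).append ((Word.Equiv.refl (width_right o)).append
    (crossRight_crossLeft rfl rfl rfl rfl Y_X o.tgt 0))
  simp only [List.nil_append, List.append_nil, List.append_assoc, List.cons_append,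
    Nat.add_zero] at h₁ h₂ h₃
  exact h₁.trans (h₂.trans h₃)

/-- A strand moves from the left of a layer to the right, by inverse crossings. -/
theorem Y_left (o : Op) : Word.Equiv (o.src + 1) (o.tgt + 1)
    ((1, o) :: crossRight (.braidInv 1 1) o.tgt)
    (crossRight (.braidInv 1 1) o.src ++ [(0, o)]) := by
  have h (a : ℕ) := Word.Equiv.refl (width_crossRight (c := .braidInv 1 1) rfl rfl a 0)
  have h₁ := ((crossRight_crossLeft rfl rfl rfl rfl X_Y o.src 0).symm.append
    (.refl (width_right o))).append (h o.tgt)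
  have h₂ := (h o.src).append ((X_right o).symm.append (h o.tgt))
  have h₃ := (h o.src).append ((Word.Equiv.refl (width_left o)).append
    (crossLeft_crossRight rfl rfl rfl rfl Y_X o.tgt 0))
  simp only [List.nil_append, List.append_nil, List.append_assoc, List.cons_append,
    Nat.add_zero] at h₁ h₂ h₃
  exact h₁.trans (h₂.trans h₃)

end RibbonHopf

namespace RibbonHopf

open Diagram

/-! ### The defining relations -/

theorem comul_coassoc : (Δ ⋄ I) ⊚ Δ ≋ (I ⋄ Δ) ⊚ Δ :=
  Eqv.of_rel (.ribbon (.hopf .coassoc))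

theorem counit_comul_left : (ε ⋄ I) ⊚ Δ ≋ I :=
  Eqv.of_rel (.ribbon (.hopf .counit_left))

theorem counit_comul_right : (I ⋄ ε) ⊚ Δ ≋ I :=
  Eqv.of_rel (.ribbon (.hopf .counit_right))

theorem mul_assoc : m ⊚ (m ⋄ I) ≋ m ⊚ (I ⋄ m) :=
  Eqv.of_rel (.ribbon (.hopf .assoc))

theorem mul_comul : (m ⋄ m) ⊚ (I ⋄ X ⋄ I) ⊚ (Δ ⋄ Δ) ≋ Δ ⊚ m :=
  Eqv.of_rel (.ribbon (.hopf .mul_comul))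

theorem counit_mul : ε ⊚ m ≋ ε ⋄ ε :=
  Eqv.of_rel (.ribbon (.hopf .mul_counit))

theorem mul_unit : m ⊚ (I ⋄ η) ≋ I :=
  Eqv.of_rel (.ribbon (.hopf .mul_unit))

theorem unit_mul : m ⊚ (η ⋄ I) ≋ I :=
  Eqv.of_rel (.ribbon (.hopf .unit_mul))

theorem comul_unit : Δ ⊚ η ≋ η ⋄ η :=
  Eqv.of_rel (.ribbon (.hopf .unit_comul))

theorem counit_unit : ε ⊚ η ≋ (ident 0) :=
  Eqv.of_rel (.ribbon (.hopf .unit_counit))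

theorem antipode_left : m ⊚ (S ⋄ I) ⊚ Δ ≋ η ⊚ ε :=
  Eqv.of_rel (.ribbon (.hopf .antipode_left))

theorem antipode_right : m ⊚ (I ⋄ S) ⊚ Δ ≋ η ⊚ ε :=
  Eqv.of_rel (.ribbon (.hopf .antipode_right))

theorem S_Sinv : S ⊚ Sinv ≋ I :=
  Eqv.of_rel (.ribbon (.hopf .S_Sinv))

theorem Sinv_S : Sinv ⊚ S ≋ I :=
  Eqv.of_rel (.ribbon (.hopf .Sinv_S))

theorem cointegral_comul : (I ⋄ l) ⊚ Δ ≋ η ⊚ l :=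
  Eqv.of_rel (.ribbon .cointegral_comul)

theorem integral_mul : m ⊚ (L ⋄ I) ≋ L ⊚ ε :=
  Eqv.of_rel (.ribbon .integral_mul)

theorem cointegral_integral : l ⊚ L ≋ (ident 0) :=
  Eqv.of_rel (.ribbon .cointegral_integral)

theorem cointegral_antipode : l ⊚ S ≋ l :=
  Eqv.of_rel (.ribbon .cointegral_antipode)

theorem antipode_integral : S ⊚ L ≋ L :=
  Eqv.of_rel (.ribbon .antipode_integral)

theorem v_vinv : v ⊚ vinv ≋ I :=
  Eqv.of_rel (.ribbon .v_vinv)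

theorem vinv_v : vinv ⊚ v ≋ I :=
  Eqv.of_rel (.ribbon .vinv_v)

theorem antipode_v : S ⊚ v ≋ v ⊚ S :=
  Eqv.of_rel (.ribbon .antipode_v)

theorem counit_v : ε ⊚ v ≋ ε :=
  Eqv.of_rel (.ribbon .counit_v)

theorem mul_v : m ⊚ (v ⋄ I) ≋ v ⊚ m :=
  Eqv.of_rel (.ribbon .mul_v)

theorem copairing_eq : σ ≋ (vinv ⋄ (vinv ⊚ S)) ⊚ Δ ⊚ v ⊚ η :=
  Eqv.of_rel (.ribbon .copairing_eq)

theorem comul_copairing : (Δ ⋄ I) ⊚ σ ≋ (I ⋄ I ⋄ m) ⊚ (I ⋄ σ ⋄ I) ⊚ σ :=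
  Eqv.of_rel (.ribbon .comul_copairing)

theorem comul_vinv : Δ ⊚ vinv ≋ (vinv ⋄ vinv) ⊚ μ ⊚ Y ⊚ Δ :=
  Eqv.of_rel (.ribbon .comul_vinv)

theorem braid_eq : (m ⋄ m) ⊚ (S ⋄ (μ ⊚ Y ⊚ μ) ⋄ S) ⊚ (ρl ⋄ ρr) ≋ X :=
  Eqv.of_rel (.ribbon .braid_eq)

theorem cointegral_copairing : (l ⋄ I) ⊚ σ ≋ L :=
  Eqv.of_rel .duality

theorem cointegral_v_unit : l ⊚ v ⊚ η ≋ (ident 0) :=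
  Eqv.of_rel .normalization

/-! ### The antipode as a braided antiautomorphism. -/

theorem antipode_unit : S ⊚ η ≋ η :=
  calc
    S ⊚ η
    _ ≋ m ⊚ (S ⋄ I) ⊚ (η ⋄ η) :=
      .of_steps [.rw mul_unit.symm 2 0, .mv 1 2] (by decide +kernel)
    _ ≋ m ⊚ (S ⋄ I) ⊚ Δ ⊚ η :=
      .of_steps [.rw comul_unit.symm 0 0] (by decide +kernel)
    _ ≋ η ⊚ ε ⊚ η :=
      .of_steps [.rw antipode_left 1 0] (by decide +kernel)
    _ ≋ η :=
      .of_steps [.rw counit_unit 0 0] (by decide +kernel)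

theorem counit_antipode : ε ⊚ S ≋ ε :=
  calc
    ε ⊚ S
    _ ≋ (ε ⋄ ε) ⊚ (S ⋄ I) ⊚ Δ :=
      .of_steps [.rw counit_comul_right.symm 0 0, .mv 1 3] (by decide +kernel)
    _ ≋ ε ⊚ m ⊚ (S ⋄ I) ⊚ Δ :=
      .of_steps [.rw counit_mul.symm 2 0] (by decide +kernel)
    _ ≋ ε ⊚ η ⊚ ε :=
      .of_steps [.rw antipode_left 0 0] (by decide +kernel)
    _ ≋ ε :=
      .of_steps [.rw counit_unit 1 0] (by decide +kernel)

theorem conv_mul_antipode : m ⊚ (m ⋄ (m ⊚ (S ⋄ S) ⊚ X)) ⊚ (I ⋄ X ⋄ I) ⊚ (Δ ⋄ Δ) ≋ η ⊚ (ε ⋄ ε) :=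
  calc
    m ⊚ (m ⋄ (m ⊚ (S ⋄ S) ⊚ X)) ⊚ (I ⋄ X ⋄ I) ⊚ (Δ ⋄ Δ)
    _ ≋ m ⊚ (m ⋄ (m ⊚ (S ⋄ S))) ⊚ (I ⋄ Δ ⋄ I) ⊚ (I ⋄ X) ⊚ (Δ ⋄ I) :=
      .of_steps [.mv 4 3, .rw (X_left .comul) 1 1] (by decide +kernel)
    _ ≋ m ⊚ (m ⋄ I) ⊚ (I ⋄ (m ⊚ (I ⋄ S) ⊚ Δ) ⋄ I) ⊚ (I ⋄ I ⋄ S) ⊚ (I ⋄ X) ⊚ (Δ ⋄ I) :=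
      .of_steps [.rw mul_assoc.symm 6 0, .mv 4 3, .mv 5 2, .rw mul_assoc 5 0] (by decide +kernel)
    _ ≋ m ⊚ (m ⋄ I) ⊚ (I ⋄ (η ⊚ ε) ⋄ I) ⊚ (I ⋄ I ⋄ S) ⊚ (I ⋄ X) ⊚ (Δ ⋄ I) :=
      .of_steps [.rw antipode_right 3 1] (by decide +kernel)
    _ ≋ m ⊚ (I ⋄ S) ⊚ Δ ⊚ (I ⋄ ε) :=
      .of_steps [.mv 3 2, .rw (X_left .counit).symm 1 1, .mv 1 3, .mv 1 2, .mv 3 4, .mv 2 3,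
        .mv 4 0, .rw mul_unit 2 0] (by decide +kernel)
    _ ≋ η ⊚ (ε ⋄ ε) :=
      .of_steps [.rw antipode_right 1 0, .mv 0 1] (by decide +kernel)

theorem conv_antipode_mul : m ⊚ ((S ⊚ m) ⋄ m) ⊚ (I ⋄ X ⋄ I) ⊚ (Δ ⋄ Δ) ≋ η ⊚ (ε ⋄ ε) :=
  calc
    m ⊚ ((S ⊚ m) ⋄ m) ⊚ (I ⋄ X ⋄ I) ⊚ (Δ ⋄ Δ)
    _ ≋ m ⊚ (S ⋄ I) ⊚ Δ ⊚ m :=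
      .of_steps [.mv 5 4, .rw mul_comul 0 0] (by decide +kernel)
    _ ≋ η ⊚ (ε ⋄ ε) :=
      .of_steps [.rw antipode_left 1 0, .rw counit_mul 0 0] (by decide +kernel)

/-- Both sides are convolution inverses of `m` among morphisms `H ⋄ H → H`: the left side is a left
inverse by `conv_antipode_mul`, the right side a right inverse by `conv_mul_antipode`. -/
theorem antipode_mul : S ⊚ m ≋ m ⊚ (S ⋄ S) ⊚ X :=
  calc
    S ⊚ m
    _ ≋ m ⊚ ((S ⊚ m) ⋄ (η ⊚ (ε ⋄ ε))) ⊚ (I ⋄ X ⋄ I) ⊚ (Δ ⋄ Δ) :=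
      .of_steps [.rw counit_comul_right.symm 0 0, .rw (X_right .counit) 1 1, .mv 2 4,
        .rw counit_comul_right.symm 1 2, .mv 2 6, .rw mul_unit.symm 7 0] (by decide +kernel)
    _ ≋ m ⊚ ((S ⊚ m) ⋄ (m ⊚ (m ⋄ (m ⊚ (S ⋄ S) ⊚ X)) ⊚ (I ⋄ X ⋄ I) ⊚ (Δ ⋄ Δ))) ⊚ (I ⋄ X ⋄ I) ⊚ (Δ ⋄
        Δ) :=
      .of_steps [.rw conv_mul_antipode.symm 5 1] (by decide +kernel)
    _ ≋ m ⊚ ((m ⊚ ((S ⊚ m) ⋄ m) ⊚ (I ⋄ X ⋄ I) ⊚ (Δ ⋄ Δ)) ⋄ (m ⊚ (S ⋄ S) ⊚ X)) ⊚ (I ⋄ X ⋄ I) ⊚ (Δ ⋄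
        Δ) :=
      .of_steps [.mv 9 8, .rw (X_left .comul) 6 2, .rw mul_assoc.symm 12 0, .mv 5 3,
        .rw (X_right .comul).symm 2 1, .mv 1 2, .mv 12 13, .mv 11 12, .mv 10 11, .mv 7 6, .mv 8 7,
        .mv 6 5, .mv 7 6, .mv 5 4, .mv 6 5, .rw (X_left .comul) 2 2, .rw comul_coassoc.symm 3 2,
        .rw comul_coassoc.symm 0 0, .rw (X_left .comul).symm 2 2, .mv 4 10, .mv 1 3
        ] (by decide +kernel)
    _ ≋ m ⊚ ((η ⊚ (ε ⋄ ε)) ⋄ (m ⊚ (S ⋄ S) ⊚ X)) ⊚ (I ⋄ X ⋄ I) ⊚ (Δ ⋄ Δ) :=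
      .of_steps [.rw conv_antipode_mul 3 0] (by decide +kernel)
    _ ≋ m ⊚ (S ⋄ S) ⊚ X :=
      .of_steps [.mv 6 5, .mv 7 6, .mv 8 7, .mv 9 8, .rw unit_mul 9 0, .mv 1 0, .mv 3 2,
        .rw counit_comul_left 1 0, .mv 3 2, .rw (X_left .comul) 0 0, .rw counit_comul_left 1 0
        ] (by decide +kernel)

theorem conv_comul_antipode : ((m ⋄ m) ⊚ (I ⋄ X ⋄ I)) ⊚ (Δ ⋄ (X ⊚ (S ⋄ S) ⊚ Δ)) ⊚ Δ ≋ (η ⋄ η) ⊚ ε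
    :=
  calc
    ((m ⋄ m) ⊚ (I ⋄ X ⋄ I)) ⊚ (Δ ⋄ (X ⊚ (S ⋄ S) ⊚ Δ)) ⊚ Δ
    _ ≋ (m ⋄ I) ⊚ (I ⋄ X) ⊚ (I ⋄ m ⋄ I) ⊚ (Δ ⋄ ((S ⋄ S) ⊚ Δ)) ⊚ Δ :=
      .of_steps [.mv 8 7, .rw (X_right .mul).symm 5 1] (by decide +kernel)
    _ ≋ (m ⋄ I) ⊚ (I ⋄ X) ⊚ (I ⋄ I ⋄ S) ⊚ (I ⋄ (m ⊚ (I ⋄ S) ⊚ Δ) ⋄ I) ⊚ (Δ ⋄ I) ⊚ Δ :=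
      .of_steps [.mv 2 1, .rw comul_coassoc.symm 0 0, .mv 4 5, .rw comul_coassoc 1 0
        ] (by decide +kernel)
    _ ≋ (m ⋄ I) ⊚ (I ⋄ X) ⊚ (I ⋄ I ⋄ S) ⊚ (I ⋄ (η ⊚ ε) ⋄ I) ⊚ (Δ ⋄ I) ⊚ Δ :=
      .of_steps [.rw antipode_right 2 1] (by decide +kernel)
    _ ≋ (I ⋄ η) ⊚ m ⊚ (I ⋄ S) ⊚ Δ :=
      .of_steps [.mv 4 3, .rw (X_right .unit) 4 1, .mv 4 5, .rw counit_comul_right 1 0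
        ] (by decide +kernel)
    _ ≋ (η ⋄ η) ⊚ ε :=
      .of_steps [.rw antipode_right 0 0] (by decide +kernel)

theorem conv_antipode_comul : (m ⋄ m) ⊚ (I ⋄ X ⋄ I) ⊚ ((Δ ⊚ S) ⋄ Δ) ⊚ Δ ≋ (η ⋄ η) ⊚ ε :=
  calc
    (m ⋄ m) ⊚ (I ⋄ X ⋄ I) ⊚ ((Δ ⊚ S) ⋄ Δ) ⊚ Δ
    _ ≋ Δ ⊚ m ⊚ (S ⋄ I) ⊚ Δ :=
      .of_steps [.rw mul_comul 2 0] (by decide +kernel)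
    _ ≋ (η ⋄ η) ⊚ ε :=
      .of_steps [.rw antipode_left 0 0, .rw comul_unit 1 0] (by decide +kernel)

/-- The dual argument: both sides are inverses of `Δ` under convolution of morphisms `H → H ⋄ H`,
the target carrying the braided product algebra structure. -/
theorem comul_antipode : Δ ⊚ S ≋ X ⊚ (S ⋄ S) ⊚ Δ :=
  calc
    Δ ⊚ S
    _ ≋ (m ⋄ m) ⊚ (I ⋄ X ⋄ I) ⊚ ((Δ ⊚ S) ⋄ ((η ⋄ η) ⊚ ε)) ⊚ Δ :=
      .of_steps [.rw mul_unit.symm 2 0, .rw (X_left .unit).symm 2 1,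
        .rw counit_comul_right.symm 0 0, .mv 1 3, .rw mul_unit.symm 7 1, .mv 6 7, .mv 5 6
        ] (by decide +kernel)
    _ ≋ (m ⋄ m) ⊚ (I ⋄ X ⋄ I) ⊚ ((Δ ⊚ S) ⋄ ((m ⋄ m) ⊚ (I ⋄ X ⋄ I) ⊚ (Δ ⋄ (X ⊚ (S ⋄ S) ⊚ Δ)) ⊚ Δ))
        ⊚ Δ :=
      .of_steps [.rw conv_comul_antipode.symm 3 2] (by decide +kernel)
    _ ≋ (m ⋄ m) ⊚ (I ⋄ X ⋄ I) ⊚ (((m ⋄ m) ⊚ (I ⋄ X ⋄ I) ⊚ ((Δ ⊚ S) ⋄ Δ) ⊚ Δ) ⋄ (X ⊚ (S ⋄ S) ⊚ Δ))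
        ⊚ Δ :=
      .of_steps [.mv 11 10, .rw (X_right .mul).symm 8 3, .mv 3 1, .rw comul_coassoc.symm 0 0,
        .rw (X_left .mul) 10 1, .mv 7 8, .mv 9 10, .mv 8 9, .mv 7 8, .mv 6 7, .mv 5 6, .mv 14 12,
        .mv 9 8, .rw (X_right .mul).symm 10 2, .rw mul_assoc.symm 9 2, .mv 8 9, .mv 7 8, .mv 6 7,
        .rw mul_assoc.symm 12 0, .mv 11 12, .mv 10 11, .mv 9 10, .mv 8 9, .mv 7 8, .mv 6 7,
        .rw (X_right .mul) 11 1, .mv 13 14] (by decide +kernel)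
    _ ≋ (m ⋄ m) ⊚ (I ⋄ X ⋄ I) ⊚ (((η ⋄ η) ⊚ ε) ⋄ (X ⊚ (S ⋄ S) ⊚ Δ)) ⊚ Δ :=
      .of_steps [.rw conv_antipode_comul 1 0] (by decide +kernel)
    _ ≋ X ⊚ (S ⋄ S) ⊚ Δ :=
      .of_steps [.rw counit_comul_left 0 0, .mv 1 0, .mv 2 1, .mv 3 2, .mv 4 3, .mv 5 4, .mv 6 5,
        .rw unit_mul 6 0, .rw (X_right .mul).symm 4 0, .mv 3 4, .mv 1 0, .mv 2 1, .rw unit_mul 2 0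
        ] (by decide +kernel)

/-! ### Centrality of the ribbon morphism. -/

theorem Sinv_v : Sinv ⊚ v ≋ v ⊚ Sinv :=
  calc
    Sinv ⊚ v
    _ ≋ Sinv ⊚ v ⊚ S ⊚ Sinv :=
      .of_steps [.rw S_Sinv.symm 0 0] (by decide +kernel)
    _ ≋ Sinv ⊚ S ⊚ v ⊚ Sinv :=
      .of_steps [.rw antipode_v.symm 1 0] (by decide +kernel)
    _ ≋ v ⊚ Sinv :=
      .of_steps [.rw Sinv_S 2 0] (by decide +kernel)

/-- The antipode exchanges the two factors of `m` and commutes with `v`, so conjugating by it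
carries `mul_v` from the left factor to the right one. -/
theorem mul_v_right : m ⊚ (I ⋄ v) ≋ v ⊚ m :=
  calc
    m ⊚ (I ⋄ v)
    _ ≋ Sinv ⊚ S ⊚ m ⊚ (I ⋄ v) :=
      .of_steps [.rw Sinv_S.symm 2 0] (by decide +kernel)
    _ ≋ Sinv ⊚ m ⊚ (S ⋄ S) ⊚ X ⊚ (I ⋄ v) :=
      .of_steps [.rw antipode_mul 1 0] (by decide +kernel)
    _ ≋ Sinv ⊚ v ⊚ m ⊚ (S ⋄ S) ⊚ X :=
      .of_steps [.rw (X_left .ribbon) 0 0, .mv 3 1, .rw antipode_v 2 0, .mv 1 2, .rw mul_v 3 0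
        ] (by decide +kernel)
    _ ≋ Sinv ⊚ v ⊚ S ⊚ m :=
      .of_steps [.rw antipode_mul.symm 0 0] (by decide +kernel)
    _ ≋ Sinv ⊚ S ⊚ v ⊚ m :=
      .of_steps [.rw antipode_v.symm 1 0] (by decide +kernel)
    _ ≋ v ⊚ m :=
      .of_steps [.rw Sinv_S 2 0] (by decide +kernel)

theorem antipode_vinv : S ⊚ vinv ≋ vinv ⊚ S :=
  calc
    S ⊚ vinv
    _ ≋ vinv ⊚ v ⊚ S ⊚ vinv :=
      .of_steps [.rw vinv_v.symm 2 0] (by decide +kernel)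
    _ ≋ vinv ⊚ S ⊚ v ⊚ vinv :=
      .of_steps [.rw antipode_v.symm 1 0] (by decide +kernel)
    _ ≋ vinv ⊚ S :=
      .of_steps [.rw v_vinv 0 0] (by decide +kernel)

theorem Sinv_vinv : Sinv ⊚ vinv ≋ vinv ⊚ Sinv :=
  calc
    Sinv ⊚ vinv
    _ ≋ vinv ⊚ v ⊚ Sinv ⊚ vinv :=
      .of_steps [.rw vinv_v.symm 2 0] (by decide +kernel)
    _ ≋ vinv ⊚ Sinv ⊚ v ⊚ vinv :=
      .of_steps [.rw Sinv_v.symm 1 0] (by decide +kernel)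
    _ ≋ vinv ⊚ Sinv :=
      .of_steps [.rw v_vinv 0 0] (by decide +kernel)

theorem counit_vinv : ε ⊚ vinv ≋ ε :=
  calc
    ε ⊚ vinv
    _ ≋ ε ⊚ v ⊚ vinv :=
      .of_steps [.rw counit_v.symm 1 0] (by decide +kernel)
    _ ≋ ε :=
      .of_steps [.rw v_vinv 0 0] (by decide +kernel)

theorem mul_vinv : m ⊚ (vinv ⋄ I) ≋ vinv ⊚ m :=
  calc
    m ⊚ (vinv ⋄ I)
    _ ≋ vinv ⊚ v ⊚ m ⊚ (vinv ⋄ I) :=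
      .of_steps [.rw vinv_v.symm 2 0] (by decide +kernel)
    _ ≋ vinv ⊚ m ⊚ (v ⋄ I) ⊚ (vinv ⋄ I) :=
      .of_steps [.rw mul_v.symm 1 0] (by decide +kernel)
    _ ≋ vinv ⊚ m :=
      .of_steps [.rw v_vinv 0 0] (by decide +kernel)

theorem mul_vinv_right : m ⊚ (I ⋄ vinv) ≋ vinv ⊚ m :=
  calc
    m ⊚ (I ⋄ vinv)
    _ ≋ vinv ⊚ v ⊚ m ⊚ (I ⋄ vinv) :=
      .of_steps [.rw vinv_v.symm 2 0] (by decide +kernel)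
    _ ≋ vinv ⊚ m ⊚ (I ⋄ v) ⊚ (I ⋄ vinv) :=
      .of_steps [.rw mul_v_right.symm 1 0] (by decide +kernel)
    _ ≋ vinv ⊚ m :=
      .of_steps [.rw v_vinv 0 1] (by decide +kernel)

/-! ### Crossings, coproducts and inverses of the copairing. -/

theorem X_comul : X ⊚ Δ ≋ (Sinv ⋄ Sinv) ⊚ Δ ⊚ S :=
  calc
    X ⊚ Δ
    _ ≋ (Sinv ⋄ Sinv) ⊚ (S ⋄ S) ⊚ X ⊚ Δ :=
      .of_steps [.rw Sinv_S.symm 2 1, .rw Sinv_S.symm 3 0, .mv 2 3] (by decide +kernel)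
    _ ≋ (Sinv ⋄ Sinv) ⊚ Δ ⊚ S :=
      .of_steps [.mv 3 2, .rw (X_right .antipode).symm 1 0, .rw (X_left .antipode).symm 2 0,
        .rw comul_antipode.symm 0 0] (by decide +kernel)

theorem X_comul_v_unit : X ⊚ Δ ⊚ v ⊚ η ≋ (Sinv ⋄ Sinv) ⊚ Δ ⊚ v ⊚ η :=
  calc
    X ⊚ Δ ⊚ v ⊚ η
    _ ≋ (Sinv ⋄ Sinv) ⊚ Δ ⊚ S ⊚ v ⊚ η :=
      .of_steps [.rw X_comul 2 0] (by decide +kernel)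
    _ ≋ (Sinv ⋄ Sinv) ⊚ Δ ⊚ v ⊚ S ⊚ η :=
      .of_steps [.rw antipode_v 1 0] (by decide +kernel)
    _ ≋ (Sinv ⋄ Sinv) ⊚ Δ ⊚ v ⊚ η :=
      .of_steps [.rw antipode_unit 0 0] (by decide +kernel)

/-- As `S` fixes `v ∘ η`, crossing the legs of `Δ ∘ v ∘ η` puts an inverse antipode on each. The one
on the left cancels the `S` brought over from the right leg of `σ`; restoring the missing `S` on the
right leaves two inverse antipodes there. -/
theorem X_copairing : X ⊚ σ ≋ (I ⋄ (Sinv ⊚ Sinv)) ⊚ σ :=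
  calc
    X ⊚ σ
    _ ≋ (vinv ⋄ vinv) ⊚ (S ⋄ I) ⊚ X ⊚ Δ ⊚ v ⊚ η :=
      .of_steps [.rw copairing_eq 0 0, .rw (X_left .ribbonInv) 5 0, .mv 4 3,
        .rw (X_right .ribbonInv) 4 0, .mv 5 6, .rw (X_left .antipode) 3 0] (by decide +kernel)
    _ ≋ (vinv ⋄ vinv) ⊚ (S ⋄ I) ⊚ (Sinv ⋄ Sinv) ⊚ Δ ⊚ v ⊚ η :=
      .of_steps [.rw X_comul_v_unit 0 0] (by decide +kernel)
    _ ≋ (vinv ⋄ (Sinv ⊚ vinv)) ⊚ Δ ⊚ v ⊚ η :=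
      .of_steps [.mv 5 4, .mv 6 5, .rw Sinv_vinv.symm 6 1, .rw S_Sinv 3 0] (by decide +kernel)
    _ ≋ (I ⋄ (Sinv ⊚ Sinv)) ⊚ σ :=
      .of_steps [.rw Sinv_S.symm 4 1, .rw Sinv_vinv.symm 5 1, .rw copairing_eq.symm 0 0
        ] (by decide +kernel)

theorem Y_copairing : Y ⊚ σ ≋ ((S ⊚ S) ⋄ I) ⊚ σ :=
  calc
    Y ⊚ σ
    _ ≋ Y ⊚ (I ⋄ (S ⊚ S ⊚ Sinv ⊚ Sinv)) ⊚ σ :=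
      .of_steps [.rw S_Sinv.symm 1 1, .rw S_Sinv.symm 2 1] (by decide +kernel)
    _ ≋ Y ⊚ (I ⋄ (S ⊚ S)) ⊚ X ⊚ σ :=
      .of_steps [.rw X_copairing.symm 0 0] (by decide +kernel)
    _ ≋ ((S ⊚ S) ⋄ I) ⊚ σ :=
      .of_steps [.rw (X_right .antipode).symm 1 0, .rw (X_right .antipode).symm 2 0, .rw Y_X 3 0
        ] (by decide +kernel)

theorem comul_antipode_antipode : Δ ⊚ S ⊚ S ≋ X ⊚ X ⊚ ((S ⊚ S) ⋄ (S ⊚ S)) ⊚ Δ :=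
  calc
    Δ ⊚ S ⊚ S
    _ ≋ X ⊚ (S ⋄ S) ⊚ X ⊚ (S ⋄ S) ⊚ Δ :=
      .of_steps [.rw comul_antipode 1 0, .rw comul_antipode 0 0] (by decide +kernel)
    _ ≋ X ⊚ X ⊚ ((S ⊚ S) ⋄ (S ⊚ S)) ⊚ Δ :=
      .of_steps [.rw (X_left .antipode).symm 3 0, .rw (X_right .antipode).symm 4 0, .mv 3 4,
        .mv 2 3] (by decide +kernel)

theorem copairing_eq_X : σ ≋ X ⊚ ((S ⊚ S) ⋄ I) ⊚ σ :=
  .of_steps [.rw X_Y.symm 1 0, .rw Y_copairing 0 0] (by decide +kernel)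

/-- Writing `σ` as a crossed copy of itself with `S ∘ S` on one leg moves `Δ` to the left leg, where
`comul_copairing` applies. The resulting squares of antipodes are absorbed by `Y_copairing`. -/
theorem copairing_comul : (I ⋄ Δ) ⊚ σ ≋ (m ⋄ I ⋄ I) ⊚ (I ⋄ σ ⋄ I) ⊚ σ :=
  calc
    (I ⋄ Δ) ⊚ σ
    _ ≋ (I ⋄ Δ) ⊚ X ⊚ ((S ⊚ S) ⋄ I) ⊚ σ :=
      .of_steps [.rw copairing_eq_X 0 0] (by decide +kernel)
    _ ≋ (X ⋄ I) ⊚ (I ⋄ X) ⊚ ((Δ ⊚ S ⊚ S) ⋄ I) ⊚ σ :=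
      .of_steps [.rw (X_right .comul).symm 3 0] (by decide +kernel)
    _ ≋ (X ⋄ I) ⊚ (I ⋄ X) ⊚ ((X ⊚ X ⊚ ((S ⊚ S) ⋄ (S ⊚ S)) ⊚ Δ) ⋄ I) ⊚ σ :=
      .of_steps [.rw comul_antipode_antipode 1 0] (by decide +kernel)
    _ ≋ (X ⋄ I) ⊚ (I ⋄ X) ⊚ ((X ⊚ X ⊚ ((S ⊚ S) ⋄ (S ⊚ S))) ⋄ I) ⊚ (I ⋄ I ⋄ m) ⊚ (I ⋄ σ ⋄ I) ⊚ σ :=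
      .of_steps [.rw comul_copairing 0 0] (by decide +kernel)
    _ ≋ (X ⋄ I) ⊚ (I ⋄ X) ⊚ ((X ⊚ X) ⋄ I) ⊚ (I ⋄ I ⋄ m) ⊚ (I ⋄ (Y ⊚ σ) ⋄ I) ⊚ Y ⊚ σ :=
      .of_steps [.mv 3 1, .mv 4 2, .mv 5 4, .mv 6 5, .rw Y_copairing.symm 3 1,
        .rw Y_copairing.symm 0 0] (by decide +kernel)
    _ ≋ (m ⋄ I ⋄ I) ⊚ (I ⋄ σ ⋄ I) ⊚ σ :=
      .of_steps [.rw (X_right (.braid 1 1)) 6 0, .mv 5 4, .rw (X_left .mul) 5 1,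
        .rw (X_left (.braidInv 1 1)) 3 0, .rw (X_left .copairing) 2 0, .mv 2 1, .mv 3 2,
        .rw X_Y 3 2, .rw (X_left .mul) 3 0, .rw X_Y 2 0, .mv 0 1, .mv 4 3,
        .rw (X_left .copairing) 1 1] (by decide +kernel)

theorem counit_copairing : (ε ⋄ I) ⊚ σ ≋ η :=
  calc
    (ε ⋄ I) ⊚ σ
    _ ≋ (ε ⋄ I) ⊚ (vinv ⋄ (vinv ⊚ S)) ⊚ Δ ⊚ v ⊚ η :=
      .of_steps [.rw copairing_eq 0 0] (by decide +kernel)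
    _ ≋ I ⊚ (vinv ⊚ S) ⊚ (ε ⋄ I) ⊚ Δ ⊚ v ⊚ η :=
      .of_steps [.mv 4 3, .mv 5 4, .rw counit_vinv 5 0, .mv 4 5, .mv 3 4] (by decide +kernel)
    _ ≋ vinv ⊚ S ⊚ v ⊚ η :=
      .of_steps [.rw counit_comul_left 2 0] (by decide +kernel)
    _ ≋ η :=
      .of_steps [.rw antipode_v 1 0, .rw vinv_v 2 0, .rw antipode_unit 0 0] (by decide +kernel)

theorem copairing_counit : (I ⋄ ε) ⊚ σ ≋ η :=
  calc
    (I ⋄ ε) ⊚ σ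
    _ ≋ (I ⋄ ε) ⊚ (vinv ⋄ (vinv ⊚ S)) ⊚ Δ ⊚ v ⊚ η :=
      .of_steps [.rw copairing_eq 0 0] (by decide +kernel)
    _ ≋ vinv ⊚ (I ⋄ ε) ⊚ Δ ⊚ v ⊚ η :=
      .of_steps [.rw counit_vinv 5 1, .mv 4 3, .mv 5 4, .rw counit_antipode 3 1
        ] (by decide +kernel)
    _ ≋ vinv ⊚ v ⊚ η :=
      .of_steps [.rw counit_comul_right 2 0] (by decide +kernel)
    _ ≋ η :=
      .of_steps [.rw vinv_v 1 0] (by decide +kernel)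

/-- Copairings multiply by nesting one inside the other, with unit `η ⋄ η`. The coproduct rules say
that a nested square of `σ` is `σ` with `Δ` on one leg, so an antipode on a leg inverts `σ` for this
product. -/
theorem nest_antipode_copairing : ((m ⊚ (S ⋄ I)) ⋄ m) ⊚ (I ⋄ σ ⋄ I) ⊚ σ ≋ η ⋄ η :=
  calc
    ((m ⊚ (S ⋄ I)) ⋄ m) ⊚ (I ⋄ σ ⋄ I) ⊚ σ
    _ ≋ ((m ⊚ (S ⋄ I)) ⋄ I) ⊚ (Δ ⋄ I) ⊚ σ :=
      .of_steps [.mv 4 2, .rw comul_copairing.symm 0 0] (by decide +kernel)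
    _ ≋ ((η ⊚ ε) ⋄ I) ⊚ σ :=
      .of_steps [.rw antipode_left 1 0] (by decide +kernel)
    _ ≋ η ⋄ η :=
      .of_steps [.rw counit_copairing 0 0, .mv 0 1] (by decide +kernel)

theorem nest_copairing_antipode : (m ⋄ (m ⊚ (S ⋄ I))) ⊚ (I ⋄ σ ⋄ I) ⊚ σ ≋ η ⋄ η :=
  calc
    (m ⋄ (m ⊚ (S ⋄ I))) ⊚ (I ⋄ σ ⋄ I) ⊚ σ
    _ ≋ (I ⋄ (m ⊚ (S ⋄ I))) ⊚ (I ⋄ Δ) ⊚ σ :=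
      .of_steps [.rw copairing_comul.symm 0 0] (by decide +kernel)
    _ ≋ (I ⋄ (η ⊚ ε)) ⊚ σ :=
      .of_steps [.rw antipode_left 1 1] (by decide +kernel)
    _ ≋ η ⋄ η :=
      .of_steps [.rw copairing_counit 0 0] (by decide +kernel)

theorem nest_copairing_left_antipode : ((m ⊚ (I ⋄ S)) ⋄ m) ⊚ (I ⋄ σ ⋄ I) ⊚ σ ≋ η ⋄ η :=
  calc
    ((m ⊚ (I ⋄ S)) ⋄ m) ⊚ (I ⋄ σ ⋄ I) ⊚ σ
    _ ≋ ((m ⊚ (I ⋄ S)) ⋄ I) ⊚ (Δ ⋄ I) ⊚ σ :=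
      .of_steps [.mv 4 2, .rw comul_copairing.symm 0 0] (by decide +kernel)
    _ ≋ ((η ⊚ ε) ⋄ I) ⊚ σ :=
      .of_steps [.rw antipode_right 1 0] (by decide +kernel)
    _ ≋ η ⋄ η :=
      .of_steps [.rw counit_copairing 0 0, .mv 0 1] (by decide +kernel)

/-- A left and a right inverse of `σ` for the nested product coincide. -/
theorem antipode_copairing : (S ⋄ I) ⊚ σ ≋ (I ⋄ S) ⊚ σ :=
  calc
    (S ⋄ I) ⊚ σ
    _ ≋ (m ⋄ m) ⊚ (S ⋄ I ⋄ I ⋄ I) ⊚ (I ⋄ η ⋄ η ⋄ I) ⊚ σ :=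
      .of_steps [.rw mul_unit.symm 2 0, .mv 1 2, .rw unit_mul.symm 4 1, .mv 3 4, .mv 2 3
        ] (by decide +kernel)
    _ ≋ (m ⋄ m) ⊚ (S ⋄ I ⋄ I ⋄ I) ⊚ (I ⋄ ((m ⋄ (m ⊚ (S ⋄ I))) ⊚ (I ⋄ σ ⋄ I) ⊚ σ) ⋄ I) ⊚ σ :=
      .of_steps [.rw nest_copairing_antipode.symm 1 1] (by decide +kernel)
    _ ≋ (m ⋄ m) ⊚ (I ⋄ ((I ⋄ S) ⊚ σ) ⋄ I) ⊚ ((m ⊚ (S ⋄ I)) ⋄ m) ⊚ (I ⋄ σ ⋄ I) ⊚ σ :=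
      .of_steps [.mv 4 3, .mv 5 4, .mv 6 5, .rw mul_assoc.symm 6 0, .mv 4 5, .mv 3 4, .mv 2 3,
        .mv 1 2, .mv 5 6, .mv 4 5, .mv 3 4, .mv 6 7, .mv 2 1, .rw mul_assoc 7 1, .mv 6 7, .mv 5 6,
        .mv 4 5] (by decide +kernel)
    _ ≋ (m ⋄ m) ⊚ (I ⋄ ((I ⋄ S) ⊚ σ) ⋄ I) ⊚ (η ⋄ η) :=
      .of_steps [.rw nest_antipode_copairing 0 0] (by decide +kernel)
    _ ≋ (I ⋄ S) ⊚ σ :=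
      .of_steps [.mv 1 0, .mv 2 1, .mv 3 2, .rw unit_mul 3 0, .mv 0 2, .rw mul_unit 2 1
        ] (by decide +kernel)

/-! ### Relations of the ribbon elements. -/

theorem vinv_unit_mul : m ⊚ ((vinv ⊚ η) ⋄ I) ≋ m ⊚ (I ⋄ (vinv ⊚ η)) :=
  calc
    m ⊚ ((vinv ⊚ η) ⋄ I)
    _ ≋ vinv ⊚ m ⊚ (η ⋄ I) :=
      .of_steps [.rw mul_vinv 1 0] (by decide +kernel)
    _ ≋ vinv :=
      .of_steps [.rw unit_mul 0 0] (by decide +kernel)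
    _ ≋ m ⊚ (I ⋄ (vinv ⊚ η)) :=
      .of_steps [.rw mul_unit.symm 0 0, .rw mul_vinv_right.symm 1 0] (by decide +kernel)

theorem vinv_unit_mul_v_unit : m ⊚ ((vinv ⊚ η) ⋄ (v ⊚ η)) ≋ η :=
  .of_steps [.mv 2 1, .mv 3 2, .rw mul_vinv 3 0, .mv 1 0, .mv 2 1, .rw unit_mul 2 0,
    .rw vinv_v 1 0] (by decide +kernel)

theorem counit_vinv_unit : ε ⊚ vinv ⊚ η ≋ (ident 0) :=
  .of_steps [.rw counit_vinv 1 0, .rw counit_unit 0 0] (by decide +kernel)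

theorem antipode_vinv_unit : S ⊚ vinv ⊚ η ≋ vinv ⊚ η :=
  .of_steps [.rw antipode_vinv 1 0, .rw antipode_unit 0 0] (by decide +kernel)

theorem comul_vinv_unit : Δ ⊚ vinv ⊚ η ≋ ((m ⊚ ((vinv ⊚ η) ⋄ I)) ⋄ (m ⊚ ((vinv ⊚ η) ⋄ I))) ⊚ σ :=
  calc
    Δ ⊚ vinv ⊚ η
    _ ≋ (vinv ⋄ vinv) ⊚ μ ⊚ Y ⊚ (η ⋄ η) :=
      .of_steps [.rw comul_vinv 1 0, .rw comul_unit 0 0] (by decide +kernel)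
    _ ≋ ((m ⊚ ((vinv ⊚ η) ⋄ I)) ⋄ (m ⊚ ((vinv ⊚ η) ⋄ I))) ⊚ σ :=
      .of_steps [.mv 1 0, .rw (Y_right .unit) 1 0, .mv 1 0, .mv 2 1, .rw unit_mul 2 0, .mv 1 0,
        .rw mul_unit 1 1, .rw unit_mul.symm 2 1, .rw mul_vinv.symm 3 1, .rw unit_mul.symm 1 0,
        .rw mul_vinv.symm 2 0] (by decide +kernel)

/-- Inserting `ε ∘ v ∘ η = id` and expanding `η ∘ ε` by the antipode axiom puts `v⁻¹ ∘ v⁻¹` above `m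
∘ (id ⋄ S) ∘ Δ ∘ v ∘ η`. Distributing the two `v⁻¹` over the factors produces `σ`. -/
theorem vinv_unit_mul_vinv_unit : m ⊚ ((vinv ⊚ η) ⋄ (vinv ⊚ η)) ≋ m ⊚ σ :=
  calc
    m ⊚ ((vinv ⊚ η) ⋄ (vinv ⊚ η))
    _ ≋ vinv ⊚ vinv ⊚ η :=
      .of_steps [.mv 2 1, .mv 3 2, .rw mul_vinv 3 0, .mv 1 0, .mv 2 1, .rw unit_mul 2 0
        ] (by decide +kernel)
    _ ≋ vinv ⊚ vinv ⊚ η ⊚ ε ⊚ v ⊚ η :=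
      .of_steps [.rw counit_unit.symm 0 0, .rw counit_v.symm 1 0] (by decide +kernel)
    _ ≋ vinv ⊚ vinv ⊚ m ⊚ (I ⋄ S) ⊚ Δ ⊚ v ⊚ η :=
      .of_steps [.rw antipode_right.symm 2 0] (by decide +kernel)
    _ ≋ m ⊚ σ :=
      .of_steps [.rw mul_vinv.symm 4 0, .rw mul_vinv_right.symm 5 0, .mv 3 4,
        .rw copairing_eq.symm 0 0] (by decide +kernel)

/-! ### Integrals and the Frobenius form. -/

theorem cointegral_Sinv : l ⊚ Sinv ≋ l :=
  calc
    l ⊚ Sinv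
    _ ≋ l ⊚ S ⊚ Sinv :=
      .of_steps [.rw cointegral_antipode.symm 1 0] (by decide +kernel)
    _ ≋ l :=
      .of_steps [.rw S_Sinv 0 0] (by decide +kernel)

theorem Sinv_integral : Sinv ⊚ L ≋ L :=
  calc
    Sinv ⊚ L
    _ ≋ Sinv ⊚ S ⊚ L :=
      .of_steps [.rw antipode_integral.symm 0 0] (by decide +kernel)
    _ ≋ L :=
      .of_steps [.rw Sinv_S 1 0] (by decide +kernel)

/-- The antipode reverses `Δ` and preserves `l`, so the one-sided cointegral is two-sided;
`mul_integral` is the analogue for `L`. -/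
theorem cointegral_comul_left : (l ⋄ I) ⊚ Δ ≋ η ⊚ l :=
  calc
    (l ⋄ I) ⊚ Δ
    _ ≋ (l ⋄ I) ⊚ Δ ⊚ S ⊚ Sinv :=
      .of_steps [.rw S_Sinv.symm 0 0] (by decide +kernel)
    _ ≋ (l ⋄ I) ⊚ X ⊚ (S ⋄ S) ⊚ Δ ⊚ Sinv :=
      .of_steps [.rw comul_antipode 1 0] (by decide +kernel)
    _ ≋ S ⊚ (I ⋄ l) ⊚ (I ⋄ S) ⊚ Δ ⊚ Sinv :=
      .of_steps [.rw (X_left .cointegral).symm 4 0, .mv 3 2, .mv 4 3] (by decide +kernel)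
    _ ≋ η ⊚ l :=
      .of_steps [.rw cointegral_antipode 2 1, .rw cointegral_comul 1 0, .rw antipode_unit 2 0,
        .rw cointegral_Sinv 0 0] (by decide +kernel)

theorem mul_integral : m ⊚ (I ⋄ L) ≋ L ⊚ ε :=
  calc
    m ⊚ (I ⋄ L)
    _ ≋ Sinv ⊚ S ⊚ m ⊚ (I ⋄ L) :=
      .of_steps [.rw Sinv_S.symm 2 0] (by decide +kernel)
    _ ≋ Sinv ⊚ m ⊚ (S ⋄ S) ⊚ X ⊚ (I ⋄ L) :=
      .of_steps [.rw antipode_mul 1 0] (by decide +kernel)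
    _ ≋ Sinv ⊚ m ⊚ ((S ⊚ L) ⋄ S) :=
      .of_steps [.rw (X_left .integral) 0 0] (by decide +kernel)
    _ ≋ L ⊚ ε :=
      .of_steps [.rw antipode_integral 0 0, .mv 1 0, .rw integral_mul 1 0,
        .rw counit_antipode 0 0, .rw Sinv_integral 1 0] (by decide +kernel)

/-- Two evaluations of `(id ⋄ l) ∘ Δ ∘ m ∘ (L ⋄ id)`: by `mul_comul`, and by the integral axioms. -/
theorem conv_form_comul_integral : m ⊚ Y ⊚ (I ⋄ ((I ⋄ form) ⊚ ((Δ ⊚ L) ⋄ I))) ⊚ Δ ≋ η ⊚ ε :=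
  calc
    m ⊚ Y ⊚ (I ⋄ ((I ⋄ form) ⊚ ((Δ ⊚ L) ⋄ I))) ⊚ Δ
    _ ≋ (m ⋄ form) ⊚ (I ⋄ X ⋄ I) ⊚ (Δ ⋄ Δ) ⊚ (L ⋄ I) :=
      .of_steps [.rw (X_right .integral).symm 1 0, .rw (X_right .comul).symm 2 0, .mv 5 4,
        .mv 6 5, .rw Y_X 6 0, .mv 0 2, .mv 5 6, .mv 4 5] (by decide +kernel)
    _ ≋ (I ⋄ l) ⊚ Δ ⊚ m ⊚ (L ⋄ I) :=
      .of_steps [.rw mul_comul 1 0] (by decide +kernel)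
    _ ≋ η ⊚ ε :=
      .of_steps [.rw cointegral_comul 2 0, .rw integral_mul 0 0, .mv 1 0, .mv 2 1,
        .rw cointegral_integral 0 1] (by decide +kernel)

theorem conv_antipode_form_comul_integral : m ⊚ (S ⋄ (S ⊚ (I ⋄ form) ⊚ ((Δ ⊚ L) ⋄ I))) ⊚ Δ ≋ η ⊚ ε
    :=
  calc
    m ⊚ (S ⋄ (S ⊚ (I ⋄ form) ⊚ ((Δ ⊚ L) ⋄ I))) ⊚ Δ
    _ ≋ m ⊚ (S ⋄ S) ⊚ X ⊚ Y ⊚ (I ⋄ ((I ⋄ form) ⊚ ((Δ ⊚ L) ⋄ I))) ⊚ Δ :=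
      .of_steps [.mv 2 1, .mv 3 2, .mv 4 3, .mv 5 4, .rw X_Y.symm 5 0] (by decide +kernel)
    _ ≋ S ⊚ m ⊚ Y ⊚ (I ⋄ ((I ⋄ form) ⊚ ((Δ ⊚ L) ⋄ I))) ⊚ Δ :=
      .of_steps [.rw antipode_mul.symm 6 0] (by decide +kernel)
    _ ≋ η ⊚ ε :=
      .of_steps [.rw conv_form_comul_integral 0 0, .rw antipode_unit 1 0] (by decide +kernel)

/-- The left side is a right convolution inverse of `S`, and the identity is a left one. -/
theorem antipode_form_comul_integral : S ⊚ (I ⋄ form) ⊚ ((Δ ⊚ L) ⋄ I) ≋ I :=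
  calc
    S ⊚ (I ⋄ form) ⊚ ((Δ ⊚ L) ⋄ I)
    _ ≋ m ⊚ ((η ⊚ ε) ⋄ (S ⊚ (I ⋄ form) ⊚ ((Δ ⊚ L) ⋄ I))) ⊚ Δ :=
      .of_steps [.rw counit_comul_left.symm 0 0, .rw unit_mul.symm 7 0, .mv 6 7, .mv 5 6, .mv 4 5,
        .mv 3 4, .mv 2 3] (by decide +kernel)
    _ ≋ m ⊚ ((m ⊚ (I ⋄ S) ⊚ Δ) ⋄ (S ⊚ (I ⋄ form) ⊚ ((Δ ⊚ L) ⋄ I))) ⊚ Δ :=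
      .of_steps [.rw antipode_right.symm 1 0] (by decide +kernel)
    _ ≋ m ⊚ (I ⋄ (m ⊚ (S ⋄ (S ⊚ (I ⋄ form) ⊚ ((Δ ⊚ L) ⋄ I))) ⊚ Δ)) ⊚ Δ :=
      .of_steps [.rw comul_coassoc 0 0, .mv 7 8, .mv 6 7, .mv 4 3, .mv 5 4, .mv 6 5, .mv 7 6,
        .mv 8 7, .mv 6 5, .mv 7 6, .rw mul_assoc 8 0] (by decide +kernel)
    _ ≋ m ⊚ (I ⋄ (η ⊚ ε)) ⊚ Δ :=
      .of_steps [.rw conv_antipode_form_comul_integral 1 1] (by decide +kernel)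
    _ ≋ I :=
      .of_steps [.rw counit_comul_right 0 0, .rw mul_unit 0 0] (by decide +kernel)

theorem form_comul_integral : (I ⋄ form) ⊚ ((Δ ⊚ L) ⋄ I) ≋ Sinv :=
  calc
    (I ⋄ form) ⊚ ((Δ ⊚ L) ⋄ I)
    _ ≋ Sinv ⊚ S ⊚ (I ⋄ form) ⊚ ((Δ ⊚ L) ⋄ I) :=
      .of_steps [.rw Sinv_S.symm 2 0, .mv 4 3, .mv 5 4, .mv 3 2, .mv 4 3] (by decide +kernel)
    _ ≋ Sinv :=
      .of_steps [.rw antipode_form_comul_integral 0 0] (by decide +kernel)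

theorem conv_comul_integral_form : m ⊚ Y ⊚ (((form ⋄ I) ⊚ (I ⋄ (Δ ⊚ L))) ⋄ I) ⊚ Δ ≋ η ⊚ ε :=
  calc
    m ⊚ Y ⊚ (((form ⋄ I) ⊚ (I ⋄ (Δ ⊚ L))) ⋄ I) ⊚ Δ
    _ ≋ (form ⋄ m) ⊚ (I ⋄ X ⋄ I) ⊚ (Δ ⋄ Δ) ⊚ (I ⋄ L) :=
      .of_steps [.rw (X_left .integral).symm 1 1, .rw (X_left .comul).symm 2 1, .mv 5 4, .mv 6 5,
        .rw Y_X 6 0, .mv 1 0] (by decide +kernel)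
    _ ≋ (l ⋄ I) ⊚ Δ ⊚ m ⊚ (I ⋄ L) :=
      .of_steps [.mv 6 5, .rw mul_comul 1 0] (by decide +kernel)
    _ ≋ η ⊚ ε :=
      .of_steps [.rw cointegral_comul_left 2 0, .rw mul_integral 0 0, .mv 1 0, .mv 2 1,
        .rw cointegral_integral 0 1] (by decide +kernel)

theorem conv_antipode_comul_integral_form : m ⊚ ((S ⊚ (form ⋄ I) ⊚ (I ⋄ (Δ ⊚ L))) ⋄ S) ⊚ Δ ≋ η ⊚ ε
    :=
  calc
    m ⊚ ((S ⊚ (form ⋄ I) ⊚ (I ⋄ (Δ ⊚ L))) ⋄ S) ⊚ Δ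
    _ ≋ m ⊚ (S ⋄ S) ⊚ X ⊚ Y ⊚ (((form ⋄ I) ⊚ (I ⋄ (Δ ⊚ L))) ⋄ I) ⊚ Δ :=
      .of_steps [.rw X_Y.symm 5 0] (by decide +kernel)
    _ ≋ S ⊚ m ⊚ Y ⊚ (((form ⋄ I) ⊚ (I ⋄ (Δ ⊚ L))) ⋄ I) ⊚ Δ :=
      .of_steps [.rw antipode_mul.symm 6 0] (by decide +kernel)
    _ ≋ η ⊚ ε :=
      .of_steps [.rw conv_comul_integral_form 0 0, .rw antipode_unit 1 0] (by decide +kernel)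

theorem antipode_comul_integral_form : S ⊚ (form ⋄ I) ⊚ (I ⋄ (Δ ⊚ L)) ≋ I :=
  calc
    S ⊚ (form ⋄ I) ⊚ (I ⋄ (Δ ⊚ L))
    _ ≋ S ⊚ (form ⋄ I) ⊚ (I ⋄ (Δ ⊚ L)) ⊚ (I ⋄ ε) ⊚ Δ :=
      .of_steps [.rw counit_comul_right.symm 0 0] (by decide +kernel)
    _ ≋ m ⊚ ((S ⊚ (form ⋄ I) ⊚ (I ⋄ (Δ ⊚ L))) ⋄ (η ⊚ ε)) ⊚ Δ :=
      .of_steps [.rw (X_right .integral).symm 2 0, .mv 1 2, .mv 0 1, .mv 2 7, .mv 1 0,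
        .rw (X_right .integral) 1 0, .rw mul_unit.symm 7 0] (by decide +kernel)
    _ ≋ m ⊚ ((S ⊚ (form ⋄ I) ⊚ (I ⋄ (Δ ⊚ L))) ⋄ (m ⊚ (S ⋄ I) ⊚ Δ)) ⊚ Δ :=
      .of_steps [.rw antipode_left.symm 6 1] (by decide +kernel)
    _ ≋ m ⊚ ((m ⊚ ((S ⊚ (form ⋄ I) ⊚ (I ⋄ (Δ ⊚ L))) ⋄ S) ⊚ Δ) ⋄ I) ⊚ Δ :=
      .of_steps [.mv 6 1, .rw comul_coassoc.symm 0 0, .rw mul_assoc.symm 8 0] (by decide +kernel)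
    _ ≋ m ⊚ ((η ⊚ ε) ⋄ I) ⊚ Δ :=
      .of_steps [.rw conv_antipode_comul_integral_form 1 0] (by decide +kernel)
    _ ≋ I :=
      .of_steps [.rw counit_comul_left 0 0, .rw unit_mul 0 0] (by decide +kernel)

theorem comul_integral_form : (form ⋄ I) ⊚ (I ⋄ (Δ ⊚ L)) ≋ Sinv :=
  calc
    (form ⋄ I) ⊚ (I ⋄ (Δ ⊚ L))
    _ ≋ Sinv ⊚ S ⊚ (form ⋄ I) ⊚ (I ⋄ (Δ ⊚ L)) :=
      .of_steps [.rw Sinv_S.symm 2 2, .mv 3 4, .mv 2 3, .mv 4 5, .mv 3 4] (by decide +kernel)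
    _ ≋ Sinv :=
      .of_steps [.rw antipode_comul_integral_form 0 0] (by decide +kernel)

/-- Two copies of `Δ ∘ L`, with `S` on their outer legs, are joined by the form. Contracting either
copy gives an inverse antipode, which cancels the `S` on that copy. -/
theorem antipode_comul_integral : (S ⋄ I) ⊚ Δ ⊚ L ≋ (I ⋄ S) ⊚ Δ ⊚ L :=
  calc
    (S ⋄ I) ⊚ Δ ⊚ L
    _ ≋ (I ⋄ form ⋄ I) ⊚ (((S ⋄ I) ⊚ Δ ⊚ L) ⋄ ((I ⋄ S) ⊚ Δ ⊚ L)) :=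
      .of_steps [.rw S_Sinv.symm 3 1, .rw comul_integral_form.symm 3 1, .mv 6 7, .mv 5 6
        ] (by decide +kernel)
    _ ≋ (I ⋄ S) ⊚ Δ ⊚ L :=
      .of_steps [.mv 3 0, .mv 4 1, .mv 5 2, .mv 6 5, .mv 7 6, .rw form_comul_integral 3 0,
        .mv 2 4, .rw S_Sinv 2 0] (by decide +kernel)

theorem X_comul_integral : X ⊚ Δ ⊚ L ≋ (Sinv ⋄ Sinv) ⊚ Δ ⊚ L :=
  calc
    X ⊚ Δ ⊚ L
    _ ≋ (Sinv ⋄ Sinv) ⊚ Δ ⊚ S ⊚ L :=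
      .of_steps [.rw X_comul 1 0] (by decide +kernel)
    _ ≋ (Sinv ⋄ Sinv) ⊚ Δ ⊚ L :=
      .of_steps [.rw antipode_integral 0 0] (by decide +kernel)

/-! ### Nondegeneracy of the copairing. -/

theorem copairing_cointegral : (I ⋄ l) ⊚ σ ≋ L :=
  calc
    (I ⋄ l) ⊚ σ
    _ ≋ (I ⋄ l) ⊚ (I ⋄ (Sinv ⊚ Sinv)) ⊚ σ :=
      .of_steps [.rw cointegral_Sinv.symm 1 1, .rw cointegral_Sinv.symm 2 1] (by decide +kernel)
    _ ≋ (I ⋄ l) ⊚ X ⊚ σ :=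
      .of_steps [.rw X_copairing.symm 0 0] (by decide +kernel)
    _ ≋ L :=
      .of_steps [.rw (X_right .cointegral).symm 1 0, .rw cointegral_copairing 0 0
        ] (by decide +kernel)

/-- With `L = (id ⋄ l) ∘ σ`, the axiom for `(Δ ⋄ id) ∘ σ` presents `Δ ∘ L` as two nested copairings
joined by `l ∘ m`. The crossing places them side by side at the price of reversing one, which
`X_copairing` corrects. -/
theorem X_comul_integral_eq_form : X ⊚ Δ ⊚ L ≋ (I ⋄ (Sinv ⊚ Sinv)) ⊚ (I ⋄ form ⋄ I) ⊚ (σ ⋄ σ) :=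
  calc
    X ⊚ Δ ⊚ L
    _ ≋ X ⊚ (Δ ⋄ l) ⊚ σ :=
      .of_steps [.rw copairing_cointegral.symm 0 0, .mv 1 2] (by decide +kernel)
    _ ≋ X ⊚ (I ⋄ I ⋄ form) ⊚ (I ⋄ σ ⋄ I) ⊚ σ :=
      .of_steps [.rw comul_copairing 0 0] (by decide +kernel)
    _ ≋ (I ⋄ form ⋄ I) ⊚ (σ ⋄ (X ⊚ σ)) :=
      .of_steps [.rw (X_left .copairing).symm 1 1, .mv 1 0, .mv 6 3, .rw (X_right .copairing) 1 0,
        .rw (X_left .cointegral) 4 1, .rw (X_left .mul) 3 1, .rw (X_right .copairing) 1 1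
        ] (by decide +kernel)
    _ ≋ (I ⋄ (Sinv ⊚ Sinv)) ⊚ (I ⋄ form ⋄ I) ⊚ (σ ⋄ σ) :=
      .of_steps [.rw X_copairing 1 2, .mv 3 4, .mv 2 3, .mv 4 5, .mv 3 4] (by decide +kernel)

theorem form_copairing_copairing : (I ⋄ form ⋄ I) ⊚ (σ ⋄ σ) ≋ Δ ⊚ L :=
  calc
    (I ⋄ form ⋄ I) ⊚ (σ ⋄ σ)
    _ ≋ (I ⋄ (S ⊚ S)) ⊚ (I ⋄ (Sinv ⊚ Sinv)) ⊚ (I ⋄ form ⋄ I) ⊚ (σ ⋄ σ) :=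
      .of_steps [.rw S_Sinv.symm 4 1, .rw S_Sinv.symm 5 1] (by decide +kernel)
    _ ≋ (I ⋄ (S ⊚ S)) ⊚ X ⊚ Δ ⊚ L :=
      .of_steps [.rw X_comul_integral_eq_form.symm 0 0] (by decide +kernel)
    _ ≋ (Sinv ⋄ S) ⊚ Δ ⊚ L :=
      .of_steps [.rw X_comul_integral 0 0, .mv 3 2, .mv 4 3, .rw S_Sinv 2 1] (by decide +kernel)
    _ ≋ (Sinv ⋄ I) ⊚ (S ⋄ I) ⊚ Δ ⊚ L :=
      .of_steps [.mv 3 2, .rw antipode_comul_integral.symm 0 0] (by decide +kernel)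
    _ ≋ Δ ⊚ L :=
      .of_steps [.rw Sinv_S 2 0] (by decide +kernel)

/-- The two copairings, one of them inside `pairing`, merge into `Δ ∘ L`; contraction with the form
gives the inverse antipode, cancelled by the `S` in `pairing`. -/
theorem pairing_copairing : (I ⋄ pairing) ⊚ (σ ⋄ I) ≋ I :=
  calc
    (I ⋄ pairing) ⊚ (σ ⋄ I)
    _ ≋ (I ⋄ form) ⊚ ((Δ ⊚ L) ⋄ I) ⊚ S :=
      .of_steps [.mv 2 0, .rw form_copairing_copairing 1 0] (by decide +kernel)
    _ ≋ I :=
      .of_steps [.rw form_comul_integral 1 0, .rw Sinv_S 0 0] (by decide +kernel)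

theorem copairing_pairing : (pairing ⋄ I) ⊚ (I ⋄ σ) ≋ I :=
  calc
    (pairing ⋄ I) ⊚ (I ⋄ σ)
    _ ≋ (form ⋄ S) ⊚ (I ⋄ ((I ⋄ form ⋄ I) ⊚ (σ ⋄ σ))) :=
      .of_steps [.mv 1 0, .rw antipode_copairing 1 3, .mv 2 3, .mv 1 2, .mv 3 4, .mv 2 3, .mv 4 6,
        .mv 3 2, .mv 4 3, .mv 5 4, .mv 2 1, .mv 3 2, .mv 4 3] (by decide +kernel)
    _ ≋ S ⊚ (form ⋄ I) ⊚ (I ⋄ (Δ ⊚ L)) :=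
      .of_steps [.rw form_copairing_copairing 0 1] (by decide +kernel)
    _ ≋ I :=
      .of_steps [.rw comul_integral_form 0 0, .rw S_Sinv 0 0] (by decide +kernel)

/-! ### Normalization of the ribbon element. -/

theorem v_integral : v ⊚ L ≋ L :=
  calc
    v ⊚ L
    _ ≋ m ⊚ ((v ⊚ L) ⋄ η) :=
      .of_steps [.rw mul_unit.symm 2 0] (by decide +kernel)
    _ ≋ m ⊚ (L ⋄ (v ⊚ η)) :=
      .of_steps [.mv 2 1, .rw mul_v 2 0, .rw mul_v_right.symm 2 0] (by decide +kernel)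
    _ ≋ L ⊚ ε ⊚ v ⊚ η :=
      .of_steps [.mv 1 0, .mv 2 1, .rw integral_mul 2 0] (by decide +kernel)
    _ ≋ L :=
      .of_steps [.rw counit_v 1 0, .rw counit_unit 0 0] (by decide +kernel)

/-- Multiplying by `l ∘ v ∘ η = id` and using the cointegral axiom backwards gives `(l ∘ v⁻¹ ⋄ l) ∘
Δ ∘ v ∘ η`. Since `l = l ∘ v ∘ v⁻¹ ∘ S`, this is `(l ⋄ (l ∘ v)) ∘ σ = l ∘ v ∘ L = l ∘ L`. -/
theorem cointegral_vinv_unit : l ⊚ vinv ⊚ η ≋ (ident 0) :=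
  calc
    l ⊚ vinv ⊚ η
    _ ≋ ((l ⊚ vinv) ⋄ l) ⊚ Δ ⊚ v ⊚ η :=
      .of_steps [.rw cointegral_v_unit.symm 0 0, .rw cointegral_comul.symm 2 0, .mv 3 5
        ] (by decide +kernel)
    _ ≋ ((l ⊚ vinv) ⋄ (l ⊚ S)) ⊚ Δ ⊚ v ⊚ η :=
      .of_steps [.rw cointegral_antipode.symm 5 0] (by decide +kernel)
    _ ≋ ((l ⊚ vinv) ⋄ (l ⊚ v ⊚ vinv ⊚ S)) ⊚ Δ ⊚ v ⊚ η :=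
      .of_steps [.rw v_vinv.symm 6 0] (by decide +kernel)
    _ ≋ (l ⋄ (l ⊚ v)) ⊚ σ :=
      .of_steps [.mv 5 4, .mv 6 5, .rw copairing_eq.symm 0 0] (by decide +kernel)
    _ ≋ l ⊚ v ⊚ L :=
      .of_steps [.rw cointegral_copairing 0 0] (by decide +kernel)
    _ ≋ (ident 0) :=
      .of_steps [.rw v_integral 0 0, .rw cointegral_integral 0 0] (by decide +kernel)

/-- Centrality collects the three factors `v⁻¹` on the legs of `σ`, and two of them combine with `σ`
to `Δ ∘ v⁻¹ ∘ η`. The cointegral axiom leaves the square of `l ∘ v⁻¹ ∘ η`. -/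
theorem pairing_vinv_unit : pairing ⊚ (m ⋄ I) ⊚ ((vinv ⊚ η) ⋄ (vinv ⊚ η) ⋄ (vinv ⊚ η)) ≋ (ident 0)
    :=
  calc
    pairing ⊚ (m ⋄ I) ⊚ ((vinv ⊚ η) ⋄ (vinv ⊚ η) ⋄ (vinv ⊚ η))
    _ ≋ ((l ⊚ vinv ⊚ vinv) ⋄ (l ⊚ vinv)) ⊚ σ :=
      .of_steps [.mv 2 1, .mv 3 2, .mv 4 3, .mv 5 4, .rw mul_vinv 5 0, .mv 1 0, .mv 2 1, .mv 3 2,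
        .mv 4 3, .rw unit_mul 4 0, .mv 4 3, .mv 5 4, .rw antipode_vinv 5 3, .mv 3 2, .mv 4 3,
        .rw antipode_unit 4 3, .mv 6 5, .mv 7 6, .rw mul_vinv_right 7 0, .mv 5 4, .mv 6 5,
        .rw mul_unit 6 0, .mv 3 2, .rw mul_vinv 3 0, .mv 2 0, .rw mul_vinv 2 0, .rw unit_mul 1 0
        ] (by decide +kernel)
    _ ≋ ((l ⊚ vinv) ⋄ l) ⊚ Δ ⊚ vinv ⊚ η :=
      .of_steps [.mv 4 2, .rw unit_mul.symm 2 1, .rw mul_vinv.symm 3 1, .rw unit_mul.symm 1 0,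
        .rw mul_vinv.symm 2 0, .rw comul_vinv_unit.symm 0 0] (by decide +kernel)
    _ ≋ (ident 0) :=
      .of_steps [.mv 5 3, .rw cointegral_comul 2 0, .rw cointegral_vinv_unit 0 0,
        .rw cointegral_vinv_unit 0 0] (by decide +kernel)

/-! ### The square of the antipode through the pairing. -/

theorem antipode_antipode_eq_pairing_Y : S ⊚ S ≋ ((pairing ⊚ Y) ⋄ I) ⊚ (I ⋄ σ) :=
  calc
    S ⊚ S
    _ ≋ (I ⋄ pairing) ⊚ ((((S ⊚ S) ⋄ I) ⊚ σ) ⋄ I) :=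
      .of_steps [.rw pairing_copairing.symm 0 0, .mv 6 8, .mv 5 7, .mv 4 6, .mv 3 5, .mv 2 4,
        .mv 1 3] (by decide +kernel)
    _ ≋ (I ⋄ pairing) ⊚ ((Y ⊚ σ) ⋄ I) :=
      .of_steps [.rw Y_copairing.symm 0 0] (by decide +kernel)
    _ ≋ ((pairing ⊚ Y) ⋄ I) ⊚ (I ⋄ σ) :=
      .of_steps [.rw (X_left .cointegral) 5 0, .rw (X_left .mul) 4 0, .mv 2 1, .mv 3 2,
        .rw X_Y 3 0, .rw (X_left .cointegral) 7 0, .rw (X_left .mul) 6 0, .mv 2 6, .mv 5 4,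
        .mv 6 5, .mv 7 6, .mv 4 3, .mv 5 4, .mv 6 5, .rw (X_left .copairing) 1 1,
        .rw (X_left .antipode) 2 3, .mv 1 2, .rw Y_X.symm 2 0, .rw (X_right .copairing) 0 0
        ] (by decide +kernel)

/-- Dual of `Y_copairing`: a zigzag inserted on the second strand exposes the previous expression
for `S ∘ S`. -/
theorem pairing_Y : pairing ⊚ Y ≋ pairing ⊚ ((S ⊚ S) ⋄ I) :=
  calc
    pairing ⊚ Y
    _ ≋ pairing ⊚ ((pairing ⊚ Y) ⋄ I ⋄ I) ⊚ (I ⋄ σ ⋄ I) :=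
      .of_steps [.rw pairing_copairing.symm 0 1, .mv 6 13, .mv 5 12, .mv 4 11, .mv 3 10, .mv 2 9,
        .mv 1 8] (by decide +kernel)
    _ ≋ pairing ⊚ ((S ⊚ S) ⋄ I) :=
      .of_steps [.rw antipode_antipode_eq_pairing_Y.symm 0 0] (by decide +kernel)

/-- The square of `S` passes along a zigzag from one leg of `σ` to the other and into the pairing,
where `pairing_Y` trades it for an inverse crossing. -/
theorem antipode_antipode_eq : S ⊚ S ≋ (I ⋄ pairing) ⊚ (X ⋄ I) ⊚ (I ⋄ σ) :=
  calc
    S ⊚ S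
    _ ≋ (I ⋄ pairing) ⊚ ((((S ⊚ S) ⋄ I) ⊚ σ) ⋄ I) :=
      .of_steps [.rw pairing_copairing.symm 0 0, .mv 6 8, .mv 5 7, .mv 4 6, .mv 3 5, .mv 2 4,
        .mv 1 3] (by decide +kernel)
    _ ≋ (I ⋄ pairing) ⊚ (((I ⋄ (S ⊚ S)) ⊚ σ) ⋄ I) :=
      .of_steps [.rw antipode_copairing 0 0, .mv 1 2, .rw antipode_copairing 0 0
        ] (by decide +kernel)
    _ ≋ (I ⋄ (pairing ⊚ Y)) ⊚ (σ ⋄ I) :=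
      .of_steps [.rw pairing_Y.symm 1 1] (by decide +kernel)
    _ ≋ (I ⋄ pairing) ⊚ (X ⋄ I) ⊚ (I ⋄ σ) :=
      .of_steps [.rw X_Y.symm 2 0, .rw (Y_right .copairing) 0 0] (by decide +kernel)

/-! ### Braided cocommutativity of the adjoint action. -/

theorem mul_X_ρl : (m ⋄ I) ⊚ (I ⋄ X) ⊚ (ρl ⋄ I) ≋ (I ⋄ m) ⊚ ((μ ⊚ Y ⊚ μ) ⋄ S) ⊚ (I ⋄ ρr) :=
  calc
    (m ⋄ I) ⊚ (I ⋄ X) ⊚ (ρl ⋄ I)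
    -- Expanding the crossing creates a second `ρl` whose left leg carries `S`; it is the nested
    -- inverse of the `σ` already present, so both disappear.
    _ ≋ (m ⋄ I) ⊚ (I ⋄ ((m ⋄ m) ⊚ (S ⋄ (μ ⊚ Y ⊚ μ) ⋄ S) ⊚ (ρl ⋄ ρr))) ⊚ (ρl ⋄ I) :=
      .of_steps [.rw braid_eq.symm 2 1] (by decide +kernel)
    _ ≋ (m ⋄ m) ⊚ (I ⋄ (μ ⊚ Y ⊚ μ) ⋄ S) ⊚ (I ⋄ m ⋄ ρr) ⊚ (((((m ⊚ (I ⋄ S)) ⋄ m) ⊚ (I ⋄ σ ⋄ I)) ⊚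
        σ) ⋄ I ⋄ I) :=
      .of_steps [.mv 2 1, .rw mul_assoc.symm 2 2, .mv 5 6, .mv 4 5, .mv 3 4, .mv 2 3, .mv 6 7,
        .mv 5 6, .mv 7 8, .mv 6 7, .mv 14 15, .mv 13 14, .mv 16 17, .mv 14 13, .mv 15 14, .mv 7 6,
        .mv 8 7, .mv 6 5, .mv 7 6, .rw mul_assoc.symm 15 0, .mv 14 15, .mv 13 14, .mv 12 13,
        .mv 11 12, .mv 10 11, .mv 9 10, .mv 8 9, .mv 7 8, .mv 6 7, .mv 5 6, .mv 4 5, .mv 3 4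
        ] (by decide +kernel)
    _ ≋ (m ⋄ m) ⊚ (I ⋄ (μ ⊚ Y ⊚ μ) ⋄ S) ⊚ (I ⋄ m ⋄ ρr) ⊚ (η ⋄ η ⋄ I ⋄ I) :=
      .of_steps [.rw nest_copairing_left_antipode 0 0] (by decide +kernel)
    _ ≋ (I ⋄ m) ⊚ ((μ ⊚ Y ⊚ μ) ⋄ S) ⊚ (I ⋄ ρr) :=
      .of_steps [.mv 1 0, .mv 2 1, .mv 3 2, .mv 4 3, .mv 5 4, .mv 6 5, .mv 7 6, .mv 8 7, .mv 9 8,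
        .mv 10 9, .mv 11 10, .mv 12 11, .rw unit_mul 12 0, .rw unit_mul 0 0] (by decide +kernel)

/-- The copairings of `ρr` and of the upper `μ` become nested and merge by `copairing_comul`; the
resulting `Δ`, together with the `S`, forms the adjoint action. -/
theorem antipode_ρr_μ_Y_μ : (I ⋄ m) ⊚ ((μ ⊚ Y ⊚ μ) ⋄ S) ⊚ (I ⋄ ρr) ≋ (m ⋄ hopf.ad) ⊚ (I ⋄ σ ⋄ I) ⊚
    Y ⊚ μ :=
  calc
    (I ⋄ m) ⊚ ((μ ⊚ Y ⊚ μ) ⋄ S) ⊚ (I ⋄ ρr)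
    _ ≋ (m ⋄ (m ⊚ (m ⋄ S))) ⊚ (m ⋄ σ ⋄ I ⋄ I) ⊚ (I ⋄ Y ⋄ I) ⊚ (Y ⋄ I ⋄ I) ⊚ (I ⋄ I ⋄ σ) ⊚ μ :=
      .of_steps [.mv 2 1, .mv 3 2, .rw mul_assoc.symm 3 1, .mv 0 3, .rw (Y_left .mul) 4 0
        ] (by decide +kernel)
    _ ≋ (m ⋄ (m ⊚ (m ⋄ S) ⊚ (I ⋄ X))) ⊚ (I ⋄ ((m ⋄ I ⋄ I) ⊚ (I ⋄ σ ⋄ I) ⊚ σ) ⋄ I) ⊚ Y ⊚ μ :=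
      .of_steps [.mv 7 6, .rw mul_assoc 7 0, .mv 3 4, .rw X_Y.symm 9 2, .mv 8 9, .mv 7 8, .mv 6 7,
        .rw (Y_left .copairing) 4 1] (by decide +kernel)
    _ ≋ (m ⋄ hopf.ad) ⊚ (I ⋄ σ ⋄ I) ⊚ Y ⊚ μ :=
      .of_steps [.rw copairing_comul.symm 4 1, .mv 5 6] (by decide +kernel)

/-- The second input ends as the left factor of the first output, so the leg of `σ` by which `μ`
multiplies it can be pulled out in front. This reverses `σ`, which accounts for `S ∘ S`. -/
theorem ad_twist : (m ⋄ I) ⊚ (I ⋄ ((m ⋄ hopf.ad) ⊚ (I ⋄ σ ⋄ I) ⊚ Y)) ⊚ (((I ⋄ (m ⊚ X)) ⊚ (((I ⋄ (S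
    ⊚ S)) ⊚ σ) ⋄ I)) ⋄ I) ≋ ((m ⋄ hopf.ad) ⊚ (I ⋄ σ ⋄ I) ⊚ Y) ⊚ μ :=
  calc
    (m ⋄ I) ⊚ (I ⋄ ((m ⋄ hopf.ad) ⊚ (I ⋄ σ ⋄ I) ⊚ Y)) ⊚ (((I ⋄ (m ⊚ X)) ⊚ (((I ⋄ (S ⊚ S)) ⊚ σ) ⋄
        I)) ⋄ I)
    _ ≋ (m ⋄ I) ⊚ (I ⋄ ((m ⋄ hopf.ad) ⊚ (I ⋄ σ ⋄ I) ⊚ Y)) ⊚ (I ⋄ m ⋄ I) ⊚ (I ⋄ X ⋄ I) ⊚ ((((S ⊚ S)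
        ⋄ I) ⊚ σ) ⋄ I ⋄ I) :=
      .of_steps [.rw antipode_copairing.symm 0 0, .mv 2 1, .rw antipode_copairing.symm 0 0
        ] (by decide +kernel)
    _ ≋ (m ⋄ I) ⊚ (I ⋄ ((m ⋄ hopf.ad) ⊚ (I ⋄ σ ⋄ I) ⊚ Y)) ⊚ (I ⋄ m ⋄ I) ⊚ (I ⋄ X ⋄ I) ⊚ ((Y ⊚ σ) ⋄
        I ⋄ I) :=
      .of_steps [.rw Y_copairing.symm 0 0] (by decide +kernel)
    _ ≋ ((m ⋄ hopf.ad) ⊚ (I ⋄ σ ⋄ I) ⊚ Y) ⊚ μ :=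
      .of_steps [.rw (Y_left .copairing).symm 0 0, .rw (Y_right (.braid 1 1)).symm 2 0,
        .rw X_Y 1 0, .mv 11 12, .mv 10 11, .mv 9 10, .mv 8 9, .mv 7 8,
        .rw (Y_right .mul).symm 1 0, .rw mul_assoc.symm 5 0, .mv 4 5, .rw (Y_left .mul).symm 2 0
        ] (by decide +kernel)

/-- The twists with `S` and with `S ∘ S` nest their copairings. By `antipode_mul` and
`copairing_comul` the right leg becomes `S ∘ m ∘ (S ⋄ id) ∘ Δ`, which is trivial, so the twists
cancel. -/
theorem ad_untwist : (m ⋄ I) ⊚ (I ⋄ ((m ⋄ I) ⊚ (I ⋄ ((m ⋄ hopf.ad) ⊚ (I ⋄ σ ⋄ I) ⊚ Y)) ⊚ (((I ⋄ (m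
    ⊚ X)) ⊚ (((I ⋄ (S ⊚ S)) ⊚ σ) ⋄ I)) ⋄ I))) ⊚ (((I ⋄ (m ⊚ X)) ⊚ (((I ⋄ S) ⊚ σ) ⋄ I)) ⋄ I) ≋ (m ⋄
    hopf.ad) ⊚ (I ⋄ σ ⋄ I) ⊚ Y :=
  calc
    (m ⋄ I) ⊚ (I ⋄ ((m ⋄ I) ⊚ (I ⋄ ((m ⋄ hopf.ad) ⊚ (I ⋄ σ ⋄ I) ⊚ Y)) ⊚ (((I ⋄ (m ⊚ X)) ⊚ (((I ⋄
        (S ⊚ S)) ⊚ σ) ⋄ I)) ⋄ I))) ⊚ (((I ⋄ (m ⊚ X)) ⊚ (((I ⋄ S) ⊚ σ) ⋄ I)) ⋄ I)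
    _ ≋ (m ⋄ I) ⊚ (I ⋄ ((m ⋄ hopf.ad) ⊚ (I ⋄ σ ⋄ I) ⊚ Y)) ⊚ (I ⋄ (m ⊚ X) ⋄ I) ⊚ (((m ⋄ (m ⊚ X ⊚
        ((S ⊚ S) ⋄ S))) ⊚ (I ⋄ σ ⋄ I) ⊚ σ) ⋄ I ⋄ I) :=
      .of_steps [.mv 4 3, .mv 5 4, .mv 6 5, .rw (X_left .mul) 6 2, .mv 3 2, .mv 4 3, .mv 5 4,
        .rw (X_right (.braid 1 1)).symm 5 2, .mv 1 4, .rw mul_assoc 8 2,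
        .rw (X_right .mul).symm 6 2, .rw mul_assoc.symm 17 0, .mv 16 17, .mv 15 16, .mv 14 15,
        .mv 13 14, .mv 12 13, .mv 11 12, .mv 10 11, .mv 9 10, .mv 8 9, .mv 7 8, .mv 6 7, .mv 5 6,
        .mv 4 5, .mv 3 4, .mv 2 3] (by decide +kernel)
    _ ≋ (m ⋄ I) ⊚ (I ⋄ ((m ⋄ hopf.ad) ⊚ (I ⋄ σ ⋄ I) ⊚ Y)) ⊚ (I ⋄ (m ⊚ X) ⋄ I) ⊚ (((m ⋄ (m ⊚ (S ⋄
        S) ⊚ X ⊚ (S ⋄ I))) ⊚ (I ⋄ σ ⋄ I) ⊚ σ) ⋄ I ⋄ I) :=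
      .of_steps [.rw (X_left .antipode) 5 1, .rw (X_right .antipode) 4 1, .mv 5 6
        ] (by decide +kernel)
    _ ≋ (m ⋄ I) ⊚ (I ⋄ ((m ⋄ hopf.ad) ⊚ (I ⋄ σ ⋄ I) ⊚ Y)) ⊚ (I ⋄ (m ⊚ X) ⋄ I) ⊚ (((I ⋄ (S ⊚ m ⊚ (S
        ⋄ I) ⊚ Δ)) ⊚ σ) ⋄ I ⋄ I) :=
      .of_steps [.rw antipode_mul.symm 4 1, .rw copairing_comul.symm 0 0] (by decide +kernel)
    _ ≋ (m ⋄ I) ⊚ (I ⋄ ((m ⋄ hopf.ad) ⊚ (I ⋄ σ ⋄ I) ⊚ Y)) ⊚ (I ⋄ (m ⊚ X) ⋄ I) ⊚ (η ⋄ η ⋄ I ⋄ I) :=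
      .of_steps [.rw antipode_left 1 1, .rw antipode_unit 2 1, .rw copairing_counit 0 0
        ] (by decide +kernel)
    _ ≋ (m ⋄ hopf.ad) ⊚ (I ⋄ σ ⋄ I) ⊚ Y :=
      .of_steps [.mv 1 0, .mv 2 1, .mv 3 2, .mv 4 3, .mv 5 4, .mv 6 5, .mv 7 6, .mv 8 7, .mv 9 8,
        .mv 10 9, .mv 11 10, .rw unit_mul 11 0, .rw (X_right .unit) 0 0, .rw mul_unit 0 0
        ] (by decide +kernel)

/-- The outer twist with `S` recovers the left side from its composite with `μ`. That composite is
known from `mul_X_ρl`, and applying the same twist to its other expression gives the right side. -/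
theorem ad_copairing_Y : (m ⋄ hopf.ad) ⊚ (I ⋄ σ ⋄ I) ⊚ Y ≋ (m ⋄ hopf.ad) ⊚ (I ⋄ X ⋄ I) ⊚ (σ ⋄ X)
    :=
  calc
    (m ⋄ hopf.ad) ⊚ (I ⋄ σ ⋄ I) ⊚ Y
    _ ≋ (m ⋄ I) ⊚ (I ⋄ ((m ⋄ I) ⊚ (I ⋄ ((m ⋄ hopf.ad) ⊚ (I ⋄ σ ⋄ I) ⊚ Y)) ⊚ (((I ⋄ (m ⊚ X)) ⊚ (((I
        ⋄ (S ⊚ S)) ⊚ σ) ⋄ I)) ⋄ I))) ⊚ (((I ⋄ (m ⊚ X)) ⊚ (((I ⋄ S) ⊚ σ) ⋄ I)) ⋄ I) :=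
      .of_steps [.rw ad_untwist.symm 0 0] (by decide +kernel)
    _ ≋ (m ⋄ I) ⊚ (I ⋄ (((m ⋄ hopf.ad) ⊚ (I ⋄ σ ⋄ I) ⊚ Y) ⊚ μ)) ⊚ (((I ⋄ (m ⊚ X)) ⊚ (((I ⋄ S) ⊚ σ)
        ⋄ I)) ⋄ I) :=
      .of_steps [.rw ad_twist 4 1] (by decide +kernel)
    _ ≋ (m ⋄ I) ⊚ (I ⋄ ((I ⋄ m) ⊚ ((μ ⊚ Y ⊚ μ) ⋄ S) ⊚ (I ⋄ ρr))) ⊚ (((I ⋄ (m ⊚ X)) ⊚ (((I ⋄ S) ⊚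
        σ) ⋄ I)) ⋄ I) :=
      .of_steps [.rw antipode_ρr_μ_Y_μ.symm 4 1] (by decide +kernel)
    _ ≋ (m ⋄ I) ⊚ (I ⋄ ((m ⋄ I) ⊚ (I ⋄ X) ⊚ (ρl ⋄ I))) ⊚ (((I ⋄ (m ⊚ X)) ⊚ (((I ⋄ S) ⊚ σ) ⋄ I)) ⋄
        I) :=
      .of_steps [.rw mul_X_ρl.symm 4 1] (by decide +kernel)
    _ ≋ (m ⋄ (m ⊚ (m ⋄ S) ⊚ (I ⋄ X))) ⊚ (I ⋄ X ⋄ I ⋄ I) ⊚ (I ⋄ I ⋄ X ⋄ I) ⊚ (((m ⋄ I ⋄ I) ⊚ (I ⋄ σ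
        ⋄ I) ⊚ σ) ⋄ X) :=
      .of_steps [.mv 4 3, .rw mul_assoc.symm 4 2, .rw (X_right .antipode) 1 1,
        .rw (X_right .mul) 5 2, .mv 2 3, .mv 1 2, .mv 3 4, .mv 7 9, .rw (X_right .antipode) 4 3,
        .mv 5 8, .mv 3 4, .rw mul_assoc.symm 6 0, .mv 5 6, .mv 4 5, .mv 3 4, .mv 2 3,
        .rw (X_right .mul) 5 1, .mv 7 8, .rw (X_right (.braid 1 1)) 3 2, .mv 5 7
        ] (by decide +kernel)
    _ ≋ (m ⋄ hopf.ad) ⊚ (I ⋄ X ⋄ I) ⊚ (σ ⋄ X) :=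
      .of_steps [.rw copairing_comul.symm 0 0, .mv 2 1, .rw (X_right .comul) 2 1, .mv 3 4
        ] (by decide +kernel)

/-- This is (h10) with its first input fed by a leg of `σ`: `copairing_comul` splits the `Δ` into
two copairings, and sliding one of them past a strand exposes `ad_copairing_Y`. -/
theorem copairing_ad_comul : (I ⋄ ((hopf.ad ⋄ I) ⊚ (I ⋄ X) ⊚ (Δ ⋄ I))) ⊚ (σ ⋄ I) ≋ (I ⋄ (Y ⊚ (I ⋄
    hopf.ad) ⊚ (Δ ⋄ I))) ⊚ (σ ⋄ I) :=
  calc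
    (I ⋄ ((hopf.ad ⋄ I) ⊚ (I ⋄ X) ⊚ (Δ ⋄ I))) ⊚ (σ ⋄ I)
    _ ≋ (I ⋄ hopf.ad ⋄ I) ⊚ (I ⋄ I ⋄ X) ⊚ ((((m ⋄ I ⋄ I) ⊚ (I ⋄ σ ⋄ I)) ⊚ σ) ⋄ I) :=
      .of_steps [.rw copairing_comul 0 0] (by decide +kernel)
    _ ≋ (((m ⋄ hopf.ad) ⊚ (I ⋄ σ ⋄ I) ⊚ Y) ⋄ I) ⊚ (I ⋄ σ) :=
      .of_steps [.mv 3 1, .rw Y_X.symm 2 0, .rw (X_right .copairing) 0 0] (by decide +kernel)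
    _ ≋ (((m ⋄ hopf.ad) ⊚ (I ⋄ X ⋄ I) ⊚ (σ ⋄ X)) ⋄ I) ⊚ (I ⋄ σ) :=
      .of_steps [.rw ad_copairing_Y 1 0] (by decide +kernel)
    _ ≋ (I ⋄ (Y ⊚ (I ⋄ hopf.ad))) ⊚ ((((m ⋄ I ⋄ I) ⊚ (I ⋄ σ ⋄ I)) ⊚ σ) ⋄ I) :=
      .of_steps [.rw (Y_right .copairing).symm 0 0, .mv 3 2, .rw X_Y 3 2, .mv 1 2, .mv 0 1,
        .mv 2 5, .rw Y_X.symm 4 1, .mv 3 4, .rw (X_left .copairing) 1 1,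
        .rw (Y_left .comul).symm 3 1, .rw (Y_left (.braid 1 1)).symm 5 2, .mv 7 8, .mv 4 5,
        .rw (Y_left .mul).symm 5 1, .rw (Y_left .antipode).symm 7 2, .mv 6 7,
        .rw (Y_left .mul).symm 7 1] (by decide +kernel)
    _ ≋ (I ⋄ (Y ⊚ (I ⋄ hopf.ad) ⊚ (Δ ⋄ I))) ⊚ (σ ⋄ I) :=
      .of_steps [.rw copairing_comul.symm 0 0] (by decide +kernel)

theorem ad_comul : (hopf.ad ⋄ I) ⊚ (I ⋄ X) ⊚ (Δ ⋄ I) ≋ Y ⊚ (I ⋄ hopf.ad) ⊚ (Δ ⋄ I) :=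
  calc
    (hopf.ad ⋄ I) ⊚ (I ⋄ X) ⊚ (Δ ⋄ I)
    _ ≋ (pairing ⋄ I ⋄ I) ⊚ (I ⋄ ((I ⋄ ((hopf.ad ⋄ I) ⊚ (I ⋄ X) ⊚ (Δ ⋄ I))) ⊚ (σ ⋄ I))) :=
      .of_steps [.rw copairing_pairing.symm 0 0, .mv 6 13, .mv 5 12, .mv 4 11, .mv 3 10, .mv 2 9,
        .mv 1 8] (by decide +kernel)
    _ ≋ (pairing ⋄ I ⋄ I) ⊚ (I ⋄ ((I ⋄ (Y ⊚ (I ⋄ hopf.ad) ⊚ (Δ ⋄ I))) ⊚ (σ ⋄ I))) :=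
      .of_steps [.rw copairing_ad_comul 0 1] (by decide +kernel)
    _ ≋ Y ⊚ (I ⋄ hopf.ad) ⊚ (Δ ⋄ I) :=
      .of_steps [.mv 8 1, .mv 9 2, .mv 10 3, .mv 11 4, .mv 12 5, .mv 13 6,
        .rw copairing_pairing 0 0] (by decide +kernel)

end RibbonHopf

/-! ### Compatibility of the assignment on generators with the relations. -/

namespace AlgBarDiagram

open Diagram BraidedPresentation

/-- The image of an elementary diagram of `AlgBar` in `Hbb`. -/
def Gen.toRibbonHopf : {a b : ℕ} → Gen a b → Diagram RibbonHopf.Gen a b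
  | _, _, .comul => RibbonHopf.Δ
  | _, _, .counit => RibbonHopf.ε
  | _, _, .mul => RibbonHopf.m
  | _, _, .unit => RibbonHopf.η
  | _, _, .antipode => RibbonHopf.S
  | _, _, .antipodeInv => RibbonHopf.Sinv
  | _, _, .wPlus => RibbonHopf.vinv ⊚ RibbonHopf.η
  | _, _, .wMinus => RibbonHopf.v ⊚ RibbonHopf.η
  | _, _, .copairing => RibbonHopf.σ
  | _, _, .pairing => RibbonHopf.pairing

/-- The image of a diagram of `AlgBar` in `Hbb`. -/
def toRibbonHopf : {a b : ℕ} → Diagram Gen a b → Diagram RibbonHopf.Gen a b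
  | _, _, .gen g => g.toRibbonHopf
  | _, _, .ident a => .ident a
  | _, _, .comp f g => .comp (toRibbonHopf f) (toRibbonHopf g)
  | _, _, .tensor f g => .tensor (toRibbonHopf f) (toRibbonHopf g)
  | _, _, .braid a b => .braid a b
  | _, _, .braidInv a b => .braidInv a b

theorem toRibbonHopf_eqId {a b : ℕ} (h : a = b) : toRibbonHopf (eqId h) = eqId h := by
  subst h; rfl

theorem toRibbonHopf_rel {a b : ℕ} {f g : Diagram Gen a b} (h : Rel f g) :
    (homMk (toRibbonHopf f) : selfdualPresentation.Hom a b) = homMk (toRibbonHopf g) := by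
  cases h with
  | hopf h =>
    cases h with
    | coassoc => exact RibbonHopf.eqv_iff.1 RibbonHopf.comul_coassoc
    | counit_left => exact RibbonHopf.eqv_iff.1 RibbonHopf.counit_comul_left
    | counit_right => exact RibbonHopf.eqv_iff.1 RibbonHopf.counit_comul_right
    | assoc => exact RibbonHopf.eqv_iff.1 RibbonHopf.mul_assoc
    | mul_comul => exact RibbonHopf.eqv_iff.1 RibbonHopf.mul_comul
    | mul_counit => exact RibbonHopf.eqv_iff.1 RibbonHopf.counit_mul
    | mul_unit => exact RibbonHopf.eqv_iff.1 RibbonHopf.mul_unit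
    | unit_mul => exact RibbonHopf.eqv_iff.1 RibbonHopf.unit_mul
    | unit_comul => exact RibbonHopf.eqv_iff.1 RibbonHopf.comul_unit
    | unit_counit => exact RibbonHopf.eqv_iff.1 RibbonHopf.counit_unit
    | antipode_left => exact RibbonHopf.eqv_iff.1 RibbonHopf.antipode_left
    | antipode_right => exact RibbonHopf.eqv_iff.1 RibbonHopf.antipode_right
    | S_Sinv => exact RibbonHopf.eqv_iff.1 RibbonHopf.S_Sinv
    | Sinv_S => exact RibbonHopf.eqv_iff.1 RibbonHopf.Sinv_S
  | h1 => exact RibbonHopf.eqv_iff.1 RibbonHopf.vinv_unit_mul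
  | h2 => exact RibbonHopf.eqv_iff.1 RibbonHopf.vinv_unit_mul_v_unit
  | h3 => exact RibbonHopf.eqv_iff.1 RibbonHopf.counit_vinv_unit
  | h4 => exact RibbonHopf.eqv_iff.1 RibbonHopf.antipode_vinv_unit
  | h5 => exact RibbonHopf.eqv_iff.1 RibbonHopf.comul_vinv_unit
  | h6 => exact RibbonHopf.eqv_iff.1 RibbonHopf.counit_copairing
  | h6' => exact RibbonHopf.eqv_iff.1 RibbonHopf.copairing_counit
  | h7 => exact RibbonHopf.eqv_iff.1 RibbonHopf.copairing_comul
  | h7' => exact RibbonHopf.eqv_iff.1 RibbonHopf.comul_copairing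
  | h8 => exact RibbonHopf.eqv_iff.1 RibbonHopf.pairing_copairing
  | h8' => exact RibbonHopf.eqv_iff.1 RibbonHopf.copairing_pairing
  | h9 => exact RibbonHopf.eqv_iff.1 RibbonHopf.vinv_unit_mul_vinv_unit
  | h10 => exact RibbonHopf.eqv_iff.1 RibbonHopf.ad_comul
  | h11 => exact RibbonHopf.eqv_iff.1 RibbonHopf.pairing_vinv_unit
  | h12 => exact RibbonHopf.eqv_iff.1 RibbonHopf.antipode_antipode_eq

theorem toRibbonHopf_diagramEq {a b : ℕ} {f g : Diagram Gen a b}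
    (h : DiagramEq (fun {_ _} => Rel) f g) :
    (homMk (toRibbonHopf f) : selfdualPresentation.Hom a b) = homMk (toRibbonHopf g) := by
  induction h with
  | of_rel h => exact toRibbonHopf_rel h
  | refl => rfl
  | symm _ ih => exact ih.symm
  | trans _ _ ih ih' => exact ih.trans ih'
  | comp_congr _ _ ih ih' => exact congrArg₂ compHom ih' ih
  | tensor_congr _ _ ih ih' => exact congrArg₂ tensorHom ih ih'
  | id_comp f => exact homMk_eq (.id_comp _)
  | comp_id f => exact homMk_eq (.comp_id _)
  | assoc f g h => exact homMk_eq (.assoc _ _ _)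
  | id_tensor_id a b => exact homMk_eq (.id_tensor_id _ _)
  | interchange f g f' g' => exact homMk_eq (.interchange _ _ _ _)
  | tensor_assoc f g h =>
    simp only [toRibbonHopf, toRibbonHopf_eqId]
    exact homMk_eq (.tensor_assoc _ _ _)
  | unit_tensor f =>
    simp only [toRibbonHopf, toRibbonHopf_eqId]
    exact homMk_eq (.unit_tensor _)
  | tensor_unit f => exact homMk_eq (.tensor_unit _)
  | braid_braidInv a b => exact homMk_eq (.braid_braidInv _ _)
  | braidInv_braid a b => exact homMk_eq (.braidInv_braid _ _)
  | braid_naturality f g => exact homMk_eq (.braid_naturality _ _)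
  | braid_tensor_right a b c =>
    simp only [toRibbonHopf, toRibbonHopf_eqId]
    exact homMk_eq (.braid_tensor_right _ _ _)
  | braid_tensor_left a b c =>
    simp only [toRibbonHopf, toRibbonHopf_eqId]
    exact homMk_eq (.braid_tensor_left _ _ _)

end AlgBarDiagram

/-! ### The strict braided functor. -/

namespace AlgBar

open AlgBarDiagram BraidedPresentation

/-- The functor from `AlgBar` to `Hbb` which sends `w₊` to `v⁻¹ ∘ η` and `w₋` to `v ∘ η`. -/
def toHbb : AlgBar ⥤ Hbb where
  obj (a : ℕ) := (a : ℕ)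
  map {a b} f := (Quot.lift (fun f => homMk (toRibbonHopf f)) (fun _ _ => toRibbonHopf_diagramEq) f :
    selfdualPresentation.Hom a b)
  map_id _ := rfl
  map_comp := by rintro _ _ _ ⟨f⟩ ⟨g⟩; rfl

theorem toHbb_eqToHom {a b : AlgBar} (h : a = b) :
    toHbb.map (eqToHom h) = eqToHom (congrArg toHbb.obj h) := by
  subst h; rfl

instance : toHbb.Monoidal :=
  Functor.CoreMonoidal.toMonoidal
    { εIso := Iso.refl (𝟙_ Hbb)
      μIso a b := Iso.refl (toHbb.obj a ⊗ toHbb.obj b)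
      μIso_hom_natural_left := by
        rintro a b ⟨f⟩ c
        exact (Category.comp_id _).trans (Category.id_comp _).symm
      μIso_hom_natural_right := by
        rintro a b c ⟨f⟩
        exact (Category.comp_id _).trans (Category.id_comp _).symm
      associativity a b c := by
        have h : 𝟙 (toHbb.obj a ⊗ toHbb.obj b) ▷ toHbb.obj c ≫
            𝟙 ((toHbb.obj a ⊗ toHbb.obj b) ⊗ toHbb.obj c) ≫
              (α_ (toHbb.obj a) (toHbb.obj b) (toHbb.obj c)).hom
          = (α_ (toHbb.obj a) (toHbb.obj b) (toHbb.obj c)).hom ≫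
            toHbb.obj a ◁ 𝟙 (toHbb.obj b ⊗ toHbb.obj c) ≫
              𝟙 (toHbb.obj a ⊗ (toHbb.obj b ⊗ toHbb.obj c)) := by
          simp
        exact (congrArg (compHom _) (congrArg (compHom _)
          (toHbb_eqToHom (Nat.add_assoc a b c)))).trans h
      left_unitality a := by
        have h : (λ_ (toHbb.obj a)).hom = 𝟙 (𝟙_ Hbb) ▷ toHbb.obj a ≫
            𝟙 (𝟙_ Hbb ⊗ toHbb.obj a) ≫ (λ_ (toHbb.obj a)).hom := by
          simp
        exact h.trans (congrArg (compHom _) (congrArg (compHom _)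
          (toHbb_eqToHom (Nat.zero_add a)))).symm
      right_unitality a := by
        have h : (ρ_ (toHbb.obj a)).hom = toHbb.obj a ◁ 𝟙 (𝟙_ Hbb) ≫
            𝟙 (toHbb.obj a ⊗ 𝟙_ Hbb) ≫ (ρ_ (toHbb.obj a)).hom := by
          simp
        exact h.trans (congrArg (compHom _) (congrArg (compHom _)
          (toHbb_eqToHom (Nat.add_zero a)))).symm }

instance : toHbb.Braided where
  braided _ _ := (Category.id_comp _).trans (Category.comp_id _).symm

theorem isStrictMonoidal_toHbb : IsStrictMonoidal toHbb where
  obj_unit := rfl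
  obj_tensor _ _ := rfl
  ε_eq := rfl
  μ_eq _ _ := rfl

end AlgBar

open Functor.LaxMonoidal Functor.OplaxMonoidal in
/-- There is a (strict) braided monoidal functor from `AlgBar` to `Hbb` which sends `H` to `H`, the
Hopf algebra structure, the copairing and the pairing to the corresponding morphisms, `w₊` to
`v⁻¹ ∘ η` and `w₋` to `v ∘ η`. -/
theorem mainTheorem1 :
    ∃ (Γ : AlgBar ⥤ Hbb) (_ : Γ.Braided) (e : Γ.obj AlgBar.H = Hbb.H),
      IsStrictMonoidal Γ ∧
      Γ.map AlgBar.comul ≫ δ Γ AlgBar.H AlgBar.H ≫ (eqToHom e ⊗ₘ eqToHom e) =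
        eqToHom e ≫ Hbb.comul ∧
      Γ.map AlgBar.counit ≫ Functor.OplaxMonoidal.η Γ = eqToHom e ≫ Hbb.counit ∧
      μ Γ AlgBar.H AlgBar.H ≫ Γ.map AlgBar.mul ≫ eqToHom e =
        (eqToHom e ⊗ₘ eqToHom e) ≫ Hbb.mul ∧
      Functor.LaxMonoidal.ε Γ ≫ Γ.map AlgBar.unit ≫ eqToHom e = Hbb.unit ∧
      Γ.map AlgBar.antipode ≫ eqToHom e = eqToHom e ≫ Hbb.antipode ∧
      Γ.map AlgBar.antipodeInv ≫ eqToHom e = eqToHom e ≫ Hbb.antipodeInv ∧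
      Functor.LaxMonoidal.ε Γ ≫ Γ.map AlgBar.copairing ≫ δ Γ AlgBar.H AlgBar.H ≫
        (eqToHom e ⊗ₘ eqToHom e) = Hbb.copairing ∧
      μ Γ AlgBar.H AlgBar.H ≫ Γ.map AlgBar.pairing ≫ Functor.OplaxMonoidal.η Γ =
        (eqToHom e ⊗ₘ eqToHom e) ≫ Hbb.pairing ∧
      Functor.LaxMonoidal.ε Γ ≫ Γ.map AlgBar.wPlus ≫ eqToHom e = Hbb.unit ≫ Hbb.ribbonInv ∧
      Functor.LaxMonoidal.ε Γ ≫ Γ.map AlgBar.wMinus ≫ eqToHom e = Hbb.unit ≫ Hbb.ribbon := by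
  -- The functor is the identity on objects, so `e` is `rfl` and each structure morphism in the
  -- statement is an identity to be cancelled.
  have hH : (eqToHom rfl ⊗ₘ eqToHom rfl : Hbb.H ⊗ Hbb.H ⟶ Hbb.H ⊗ Hbb.H) = 𝟙 (Hbb.H ⊗ Hbb.H) :=
    id_tensorHom_id _ _
  have h_out {a : Hbb} (f : a ⟶ Hbb.H ⊗ Hbb.H) :
      f ≫ 𝟙 (Hbb.H ⊗ Hbb.H) ≫ (eqToHom rfl ⊗ₘ eqToHom rfl) = f := by
    rw [hH, Category.comp_id, Category.comp_id]
  refine ⟨AlgBar.toHbb, inferInstance, rfl, AlgBar.isStrictMonoidal_toHbb, ?_, ?_, ?_, ?_, ?_, ?_,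
    ?_, ?_, ?_, ?_⟩
  · exact (h_out Hbb.comul).trans (Category.id_comp _).symm
  · exact (Category.comp_id _).trans (Category.id_comp _).symm
  · exact (Category.id_comp _).trans ((Category.comp_id _).trans
      ((congrArg (· ≫ Hbb.mul) hH).trans (Category.id_comp _)).symm)
  · exact (Category.id_comp _).trans (Category.comp_id _)
  · exact (Category.comp_id _).trans (Category.id_comp _).symm
  · exact (Category.comp_id _).trans (Category.id_comp _).symm
  · exact (Category.id_comp _).trans (h_out Hbb.copairing)
  · exact (Category.id_comp _).trans ((Category.comp_id _).trans
      ((congrArg (· ≫ Hbb.pairing) hH).trans (Category.id_comp _)).symm)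
  · exact (Category.id_comp _).trans (Category.comp_id _)
  · exact (Category.id_comp _).trans (Category.comp_id _)
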